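/- Let $n\ge 0$ and $k\ge 3$. For a finite set $J$ let $\operatorname{Conf}(J,\mathbb R^n)\subset(\mathbb R^n)^J$ be the space of injective maps $J\to\mathbb R^n$, and let $\mathcal C_k$ be the $k$-cube $S\mapsto \operatorname{Conf}(\underline k\setminus S,\mathbb R^n)\cong\operatorname{Conf}(k-|S|,\mathbb R^n)$, $S\subseteq\underline k=\{1,\dots,k\}$, where $S\subseteq T$ is sent to the projection that forgets the points labelled by $T\setminus S$. Fix a direction $i\in\underline k$ and a configuration $b=(b_j)_{j\ne i}\in\mathcal C_k(\{i\})$; its images give compatible basepoints of the spaces $\mathcal C_k(S\cup\{i\})$. Let $\mathcal C_k^{\mathrm{fib}}$ be the $(k-1)$-cube $$S\longmapsto \operatorname{hofiber}\big(\mathcal C_k(S)\to\mathcal C_k(S\cup\{i\})\big),\qquad S\subseteq\underline k\setminus\{i\}.$$ A cube $\mathcal X$ with finite set of directions $\iota$ is cocartesian if the canonical map $\operatorname{hocolim}_{U\subsetneq \iota}\mathcal X_U\to \mathcal X_{\iota}$ is a weak equivalence, and it is strongly cocartesian if all its faces $U\mapsto \mathcal X_{T\cup U}$, $U\subseteq S\setminus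 T$, with $T\subseteq S\subseteq\iota$ and $|S\setminus T|\ge 2$, are cocartesian. Then $\mathcal C_k^{\mathrm{fib}}$ is strongly cocartesian. Moreover, let $P(S)=\mathbb R^n\setminus\{b_j : j\notin S\cup\{i\}\}$ for $S\subseteq\underline k\setminus\{i\}$. These punctured Euclidean spaces and their inclusions form a $(k-1)$-cube, and there is a map of cubes $P\to\mathcal C_k^{\mathrm{fib}}$ that takes $x\in P(S)$ to the configuration with $x$ as its $i$-th point and with the constant path, and that is a weak equivalence $P(S)\to\mathcal C_k^{\mathrm{fib}}(S)$ for every $S$. Each square face of $P$ is an intersection–union square of open sets: for distinct $p,q\in\underline k\setminus (S\cup\{i\})$ the sets $P(S\cup\{p\})$ and $P(S\cup\{q\})$ are open, and $$P(S)=P(S\cup\{p\})\cap P(S\cup\{q\}),\qquad P(S\cup\{p,q\})=P(S\cup\{p\})\cup P(S\cup\{q\}).$$ -/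

import Mathlib

open CategoryTheory unitInterval

noncomputable section

/-! ### Homotopy fibers and weak equivalences -/

/-- The homotopy fiber of `f : X → Y` over `y`: pairs of a point `x` and a path in `Y`
from `f x` to `y`, as a subspace of `X × Map(I, Y)` (compact-open topology). -/
def HoFiber {X Y : Type} [TopologicalSpace X] [TopologicalSpace Y] (f : C(X, Y)) (y : Y) : Type :=
  {p : X × C(I, Y) // p.2 0 = f p.1 ∧ p.2 1 = y}

instance {X Y : Type} [TopologicalSpace X] [TopologicalSpace Y] (f : C(X, Y)) (y : Y) :
    TopologicalSpace (HoFiber f y) :=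
  inferInstanceAs (TopologicalSpace {p : X × C(I, Y) // p.2 0 = f p.1 ∧ p.2 1 = y})

/-- The map of homotopy fibers induced by a commutative square and a map of basepoints:
`(x, α) ↦ (g x, h ∘ α)`. -/
def HoFiber.map {X Y X' Y' : Type} [TopologicalSpace X] [TopologicalSpace Y]
    [TopologicalSpace X'] [TopologicalSpace Y'] {f : C(X, Y)} {f' : C(X', Y')} {y : Y} {y' : Y'}
    (g : C(X, X')) (h : C(Y, Y')) (comm : ∀ x, h (f x) = f' (g x)) (base : h y = y') :
    C(HoFiber f y, HoFiber f' y') where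
  toFun p := ⟨(g p.1.1, h.comp p.1.2), by
    refine ⟨?_, ?_⟩
    · simp [p.2.1, comm]
    · simp [p.2.2, base]⟩
  continuous_toFun := by
    refine Continuous.subtype_mk (Continuous.prodMk ?_ ?_) _
    · exact g.continuous.comp (continuous_fst.comp continuous_subtype_val)
    · exact (ContinuousMap.continuous_postcomp h).comp
        (continuous_snd.comp continuous_subtype_val)

/-- A space is weakly contractible if it is nonempty and all its homotopy groups (and its set of
path components) are trivial at all basepoints. -/
def WeaklyContractible (X : Type) [TopologicalSpace X] : Prop :=
  Nonempty X ∧ ∀ (m : ℕ) (x : X), Subsingleton (HomotopyGroup.Pi m X x)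

/-- A map is a weak equivalence (that is, infinitely connected) if its homotopy fibers over all
points of the target are weakly contractible. -/
def IsWeakEquiv {X Y : Type} [TopologicalSpace X] [TopologicalSpace Y] (f : C(X, Y)) : Prop :=
  ∀ y : Y, WeaklyContractible (HoFiber f y)

/-! ### Cubical diagrams -/

/-- A cube of topological spaces with set of directions `ι`; its dimension is the number of
elements of `ι`. -/
abbrev TopCube (ι : Type) := Finset ι ⥤ TopCat.{0}

/-- The map `X_S → X_T` of a cube, for `S ⊆ T`. -/
def TopCube.arrow {ι : Type} (X : TopCube ι) {S T : Finset ι} (h : S ⊆ T) :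
    C(X.obj S, X.obj T) :=
  (X.map (homOfLE h)).hom

theorem TopCube.arrow_self {ι : Type} (X : TopCube ι) {S : Finset ι} (h : S ⊆ S) (x : X.obj S) :
    X.arrow h x = x := by
  simp [TopCube.arrow]

theorem TopCube.arrow_arrow {ι : Type} (X : TopCube ι) {S T U : Finset ι} (h : S ⊆ T) (h' : T ⊆ U)
    (x : X.obj S) : X.arrow h' (X.arrow h x) = X.arrow (h.trans h') x := by
  have e : X.map (homOfLE (h.trans h')) = X.map (homOfLE h) ≫ X.map (homOfLE h') := by
    rw [← X.map_comp]
    rfl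
  simp only [TopCube.arrow, e]
  rfl

/-- The face `∂_T^S X` of a cube, the cube `U ↦ X_{T ∪ U}` for `U ⊆ S \ T`. -/
def TopCube.face {ι : Type} [DecidableEq ι] (X : TopCube ι) (T S : Finset ι) :
    TopCube {j : ι // j ∈ S \ T} :=
  Monotone.functor (f := fun U : Finset {j : ι // j ∈ S \ T} =>
      T ∪ U.map (Function.Embedding.subtype _))
    (fun _ _ h => Finset.union_subset_union_right (Finset.map_subset_map.2 h)) ⋙ X

/-- The simplex with set of vertices `ι \ S`, as a face of the standard simplex on `ι`. -/
def FaceSimplex {ι : Type} [Fintype ι] (S : Finset ι) : Type :=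
  {t : ι → ℝ // t ∈ stdSimplex ℝ ι ∧ ∀ j ∈ S, t j = 0}

instance {ι : Type} [Fintype ι] (S : Finset ι) : TopologicalSpace (FaceSimplex S) :=
  inferInstanceAs (TopologicalSpace {t : ι → ℝ // t ∈ stdSimplex ℝ ι ∧ ∀ j ∈ S, t j = 0})

/-- For `S ⊆ T`, the simplex on `ι \ T` is a face of the simplex on `ι \ S`. -/
def FaceSimplex.incl {ι : Type} [Fintype ι] {S T : Finset ι} (h : S ⊆ T) (t : FaceSimplex T) :
    FaceSimplex S :=
  ⟨t.1, t.2.1, fun j hj => t.2.2 j (h hj)⟩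

/-- The disjoint union, over the proper subsets `S` of `ι`, of `X_S × Δ(ι \ S)`. -/
abbrev TopCube.PreHocolim {ι : Type} [Fintype ι] (X : TopCube ι) : Type :=
  Σ S : {S : Finset ι // S ≠ Finset.univ}, X.obj S.1 × FaceSimplex S.1

/-- The gluing: for `S ⊆ T` proper, `x ∈ X_S` and `t ∈ Δ(ι \ T) ⊆ Δ(ι \ S)`, the point `(x, t)` is
identified with the point whose first component is the image of `x` in `X_T`, and whose second
component is `t`. -/
inductive TopCube.HocolimRel {ι : Type} [Fintype ι] (X : TopCube ι) :
    X.PreHocolim → X.PreHocolim → Prop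
  | glue (S T : {S : Finset ι // S ≠ Finset.univ}) (h : S.1 ⊆ T.1) (x : X.obj S.1)
      (t : FaceSimplex T.1) : HocolimRel X ⟨S, (x, t.incl h)⟩ ⟨T, (X.arrow h x, t)⟩

/-- The homotopy colimit of the punctured cube obtained from `X` by removing the final space,
with the quotient topology. -/
def TopCube.Hocolim {ι : Type} [Fintype ι] (X : TopCube ι) : Type :=
  Quot X.HocolimRel

instance {ι : Type} [Fintype ι] (X : TopCube ι) : TopologicalSpace X.Hocolim :=
  inferInstanceAs (TopologicalSpace (Quot X.HocolimRel))

/-- The canonical map `b(X)` from the homotopy colimit of the punctured cube to the final space. -/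
def TopCube.hocolimMap {ι : Type} [Fintype ι] (X : TopCube ι) :
    C(X.Hocolim, X.obj Finset.univ) where
  toFun := Quot.lift (fun p : X.PreHocolim => X.arrow (Finset.subset_univ p.1.1) p.2.1) (by
    rintro _ _ ⟨S, T, h, x, t⟩
    exact (X.arrow_arrow h (Finset.subset_univ T.1) x).symm)
  continuous_toFun := by
    refine continuous_quot_lift _ (continuous_sigma fun S => ?_)
    exact (X.arrow (Finset.subset_univ S.1)).continuous.comp continuous_fst

/-- A cube is cocartesian if the canonical map `b(X)` is a weak equivalence. -/
def TopCube.Cocartesian {ι : Type} [Fintype ι] (X : TopCube ι) : Prop :=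
  IsWeakEquiv X.hocolimMap

/-- A cube is strongly cocartesian if all its faces of dimension at least `2` are cocartesian. -/
def TopCube.StronglyCocartesian {ι : Type} [DecidableEq ι] (X : TopCube ι) : Prop :=
  ∀ T S : Finset ι, T ⊆ S → 2 ≤ (S \ T).card → (X.face T S).Cocartesian

/-- A subset of `ι \ {i}`, regarded as a subset of `ι`. -/
abbrev liftSet {ι : Type} {i : ι} (S : Finset {j : ι // j ≠ i}) : Finset ι :=
  S.map (Function.Embedding.subtype _)

theorem notMem_liftSet {ι : Type} {i : ι} (S : Finset {j : ι // j ≠ i}) : i ∉ liftSet S := by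
  simp [liftSet]

/-- The cube of homotopy fibers of `X` in the direction `i`, namely the cube with set of directions
`ι \ {i}` that takes `S` to the homotopy fiber of `X_S → X_{S ∪ {i}}`. The basepoint of
`X_{S ∪ {i}}` is the image of the basepoint `y` of `X_{{i}}`, so that the basepoints are
compatible. -/
def TopCube.hofiberCube {ι : Type} [DecidableEq ι] (X : TopCube ι) (i : ι) (y : X.obj {i}) :
    TopCube {j : ι // j ≠ i} where
  obj S := TopCat.of (HoFiber
    (X.arrow (Finset.subset_insert i (liftSet S)))
    (X.arrow (Finset.singleton_subset_iff.2 (Finset.mem_insert_self i (liftSet S))) y))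
  map {S T} h := TopCat.ofHom (HoFiber.map
    (X.arrow (Finset.map_subset_map.2 (leOfHom h)))
    (X.arrow (Finset.insert_subset_insert i (Finset.map_subset_map.2 (leOfHom h))))
    (fun x => by rw [X.arrow_arrow, X.arrow_arrow])
    (by rw [X.arrow_arrow]))
  map_id S := by
    ext p
    refine Subtype.ext (Prod.ext ?_ (ContinuousMap.ext fun t => ?_))
    · exact X.arrow_self _ _
    · exact X.arrow_self _ _
  map_comp {S T U} f g := by
    ext p
    refine Subtype.ext (Prod.ext ?_ (ContinuousMap.ext fun t => ?_))
    · exact (X.arrow_arrow _ _ _).symm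
    · exact (X.arrow_arrow _ _ _).symm

/-! ### Configuration spaces -/

/-- The configuration space of points of `E` labelled by `J`, as a subspace of `J → E`. -/
def Conf (J E : Type) : Type :=
  {x : J → E // Function.Injective x}

instance (J E : Type) [TopologicalSpace E] : TopologicalSpace (Conf J E) :=
  inferInstanceAs (TopologicalSpace {x : J → E // Function.Injective x})

/-- The `k`-cube of configuration spaces, which takes `S` to the space of configurations in `ℝⁿ` of
`k - |S|` points, labelled by the complement of `S`, and whose maps forget points. -/
def confCube (n k : ℕ) : TopCube (Fin k) where
  obj S := TopCat.of (Conf {j : Fin k // j ∉ S} (EuclideanSpace ℝ (Fin n)))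
  map h := TopCat.ofHom
    { toFun := fun x => ⟨fun j => x.1 ⟨j.1, fun hj => j.2 (leOfHom h hj)⟩, fun a b hab =>
        Subtype.ext (congrArg (fun c => c.1) (x.2 hab))⟩
      continuous_toFun := by
        refine Continuous.subtype_mk (continuous_pi fun j => ?_) _
        exact (continuous_apply _).comp continuous_subtype_val }
  map_id _ := rfl
  map_comp _ _ := rfl

/-- The complement in `ℝⁿ` of the points `b j` with `j ∉ S`. -/
def puncturedSpace {n : ℕ} {J : Type} (b : J → EuclideanSpace ℝ (Fin n)) (S : Finset J) :
    Set (EuclideanSpace ℝ (Fin n)) :=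
  {x | ∀ j, j ∉ S → x ≠ b j}

/-- The cube of punctured Euclidean spaces `S ↦ ℝⁿ \ {b j | j ∉ S}`, whose maps are the
inclusions. -/
def puncturedCube {n : ℕ} {J : Type} (b : J → EuclideanSpace ℝ (Fin n)) : TopCube J where
  obj S := TopCat.of (puncturedSpace b S)
  map h := TopCat.ofHom
    { toFun := fun x => ⟨x.1, fun j hj => x.2 j (fun hS => hj (leOfHom h hS))⟩
      continuous_toFun := Continuous.subtype_mk continuous_subtype_val _ }
  map_id _ := rfl
  map_comp _ _ := rfl

/-- The points of a configuration in the space `C_k({i})`, as a family labelled by the `j ≠ i`. -/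
def confPoints {n k : ℕ} {i : Fin k} (y : (confCube n k).obj {i}) (j : {j : Fin k // j ≠ i}) :
    EuclideanSpace ℝ (Fin n) :=
  y.1 ⟨j.1, fun h => j.2 (Finset.mem_singleton.1 h)⟩

end

noncomputable section

/-! ### Homotopy equivalences have weakly contractible homotopy fibers -/

/-! A point of a homotopy fiber is a point `x`, the one labelled by `i`, together with obstacles
that move disjointly along paths and end at the fixed configuration `b`; the obstacles avoid `x` at
time `0`. Dragging `x` along with the obstacles until they stop gives a point of the punctured
space, so `P(S)` is equivalent to the homotopy fiber: the dragged point at time `s`, with the paths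
after time `s`, is a homotopy to a configuration with constant paths
(`FibCube.isHtpyEquiv_ofPunctured`).

For `P` the claim is about open covers. In a face of dimension at least `2`, the open sets omitting
one of the distinct points `p j` cover the final space, and the other spaces of the punctured face
are their intersections. A partition of unity gives a section of the canonical map from the homotopy
colimit, and a linear homotopy in the simplex coordinate makes it an inverse up to homotopy
(`PuncturedCube.isHtpyEquiv_hocolimMap`).

To transfer this to the fibers, the map `P → C^fib` has to induce an equivalence of homotopy
colimits. Dragging does not commute with forgetting points, because a forgotten obstacle no longer
pushes. The simplex coordinate repairs this: it determines how much each obstacle counts. An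
obstacle of weight zero has no influence, while those of large weight are avoided; small weights are
then made zero by `sharpen`, so that the obstacles that were perhaps not avoided may be forgotten.
The result is an explicit homotopy inverse (`FibCube.isHtpyEquiv_hocolimFunctor`). Everything
depends continuously on the paths and weights because radii and step lengths are given by formulas
rather than chosen (`Drag.continuous_drag`).

Two out of three in a commutative square finishes the argument for homotopy equivalences. These are
weak equivalences in the sense of homotopy fibers by `IsHtpyEquiv.isWeakEquiv`. -/

/-- A map is a homotopy equivalence if it has a homotopy inverse. -/
def IsHtpyEquiv {X Y : Type} [TopologicalSpace X] [TopologicalSpace Y] (f : C(X, Y)) : Prop :=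
  ∃ g : C(Y, X), (g.comp f).Homotopic (.id X) ∧ (f.comp g).Homotopic (.id Y)

theorem IsHtpyEquiv.comp {X Y Z : Type} [TopologicalSpace X] [TopologicalSpace Y]
    [TopologicalSpace Z] {f : C(X, Y)} {f' : C(Y, Z)} (h' : IsHtpyEquiv f') (h : IsHtpyEquiv f) :
    IsHtpyEquiv (f'.comp f) := by
  obtain ⟨g, h₁, h₂⟩ := h
  obtain ⟨g', h₁', h₂'⟩ := h'
  let e := ContinuousMap.HomotopyEquiv.trans ⟨f, g, h₁, h₂⟩ ⟨f', g', h₁', h₂'⟩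
  exact ⟨e.invFun, e.left_inv, e.right_inv⟩

theorem IsHtpyEquiv.of_homotopic {X Y : Type} [TopologicalSpace X] [TopologicalSpace Y]
    {f f' : C(X, Y)} (h : IsHtpyEquiv f) (hf : f.Homotopic f') : IsHtpyEquiv f' := by
  obtain ⟨g, h₁, h₂⟩ := h
  exact ⟨g, ((ContinuousMap.Homotopic.refl g).comp hf.symm).trans h₁,
    (hf.symm.comp (ContinuousMap.Homotopic.refl g)).trans h₂⟩

theorem IsHtpyEquiv.of_comp {X Y Z : Type} [TopologicalSpace X] [TopologicalSpace Y]
    [TopologicalSpace Z] {f : C(X, Y)} {f' : C(Y, Z)} (h : IsHtpyEquiv f)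
    (h' : IsHtpyEquiv (f'.comp f)) : IsHtpyEquiv f' := by
  obtain ⟨g, h₁, h₂⟩ := h
  have hg : IsHtpyEquiv g := ⟨f, h₂, h₁⟩
  refine (h'.comp hg).of_homotopic ?_
  exact (ContinuousMap.Homotopic.refl f').comp h₂

/-! ### Free cubes in homotopy fibers -/

/-- The space of maps from the cube `I^m` to `X` that are constant on the boundary. -/
def FreeCube (m : ℕ) (X : Type) [TopologicalSpace X] : Type :=
  {u : C(Fin m → I, X) // ∀ z ∈ Cube.boundary (Fin m), ∀ z' ∈ Cube.boundary (Fin m), u z = u z'}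

instance (m : ℕ) (X : Type) [TopologicalSpace X] : TopologicalSpace (FreeCube m X) :=
  inferInstanceAs (TopologicalSpace {u : C(Fin m → I, X) //
    ∀ z ∈ Cube.boundary (Fin m), ∀ z' ∈ Cube.boundary (Fin m), u z = u z'})

namespace FreeCube

variable {m : ℕ} {X Y : Type} [TopologicalSpace X] [TopologicalSpace Y]

/-- The constant cube. -/
def const (m : ℕ) (x : X) : FreeCube m X := ⟨ContinuousMap.const _ x, fun _ _ _ _ => rfl⟩

theorem continuous_eval {A : Type} [TopologicalSpace A] {u : A → FreeCube m X} (hu : Continuous u)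
    {z : A → Fin m → I} (hz : Continuous z) : Continuous fun a => (u a).1 (z a) :=
  (continuous_subtype_val.comp hu).eval hz

theorem continuous_of_uncurry {A : Type} [TopologicalSpace A] {u : A → FreeCube m X}
    (hu : Continuous fun p : A × (Fin m → I) => (u p.1).1 p.2) : Continuous u :=
  Continuous.subtype_mk (ContinuousMap.continuous_of_continuous_uncurry _ hu) _

/-- Composition with a map. -/
def map (m : ℕ) (f : C(X, Y)) : C(FreeCube m X, FreeCube m Y) where
  toFun u := ⟨f.comp u.1, fun z hz z' hz' => congrArg f (u.2 z hz z' hz')⟩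
  continuous_toFun := continuous_of_uncurry
    (f.continuous.comp (continuous_eval continuous_fst continuous_snd))

theorem map_homotopic (m : ℕ) {f g : C(X, Y)} (h : f.Homotopic g) :
    (map m f).Homotopic (map m g) := by
  obtain ⟨H⟩ := h
  refine ⟨⟨⟨fun p => ⟨⟨fun z => H (p.1, p.2.1 z), ?_⟩, fun z hz z' hz' => ?_⟩, ?_⟩, ?_, ?_⟩⟩
  · exact H.continuous.comp (continuous_const.prodMk p.2.1.continuous)
  · exact congrArg (fun x => H (p.1, x)) (p.2.2 z hz z' hz')
  · refine continuous_of_uncurry (H.continuous.comp (Continuous.prodMk ?_ ?_))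
    · exact continuous_fst.comp continuous_fst
    · exact continuous_eval (continuous_snd.comp continuous_fst) continuous_snd
  · intro u
    refine Subtype.ext (ContinuousMap.ext fun z => ?_)
    exact H.apply_zero _
  · intro u
    refine Subtype.ext (ContinuousMap.ext fun z => ?_)
    exact H.apply_one _

/-- By adjunction a path of free cubes in the homotopy fiber is a path `u` of free cubes in `X` with
a compatible family `W` of paths of free cubes in `Y`. The ends are compared pointwise, which avoids
equalities in nested subtypes. -/
theorem joined_hoFiber {f : C(X, Y)} {y : Y} (u : C(I, FreeCube m X)) (W : C(I × I, FreeCube m Y))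
    (h₀ : ∀ s, W (s, 0) = map m f (u s)) (h₁ : ∀ s, W (s, 1) = const m y)
    (γ₀ γ₁ : FreeCube m (HoFiber f y))
    (e₀ : ∀ z, (γ₀.1 z).1.1 = (u 0).1 z ∧ ∀ t, (γ₀.1 z).1.2 t = (W (0, t)).1 z)
    (e₁ : ∀ z, (γ₁.1 z).1.1 = (u 1).1 z ∧ ∀ t, (γ₁.1 z).1.2 t = (W (1, t)).1 z) :
    Joined γ₀ γ₁ := by
  have hc : Continuous fun p : (I × (Fin m → I)) × I => (W (p.1.1, p.2)).1 p.1.2 :=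
    continuous_eval (W.continuous.comp (by fun_prop)) (by fun_prop)
  have hu : Continuous fun p : I × (Fin m → I) => (u p.1).1 p.2 :=
    continuous_eval (u.continuous.comp (by fun_prop)) (by fun_prop)
  have hF : Continuous fun p : I × (Fin m → I) =>
      (⟨((u p.1).1 p.2, ⟨fun t => (W (p.1, t)).1 p.2, hc.comp
          (by fun_prop : Continuous fun t : I => ((p.1, p.2), t))⟩),
        congrArg (fun a : FreeCube m Y => a.1 p.2) (h₀ p.1),
        congrArg (fun a : FreeCube m Y => a.1 p.2) (h₁ p.1)⟩ : HoFiber f y) := by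
    refine Continuous.subtype_mk (hu.prodMk ?_) _
    exact ContinuousMap.continuous_of_continuous_uncurry _ hc
  refine ⟨⟨⟨fun s => ⟨⟨_, hF.comp (continuous_const.prodMk continuous_id :
    Continuous fun z : Fin m → I => (s, z))⟩, fun z hz z' hz' => ?_⟩, ?_⟩, ?_, ?_⟩⟩
  · refine Subtype.ext (Prod.ext ((u s).2 z hz z' hz') (ContinuousMap.ext fun t => ?_))
    exact (W (s, t)).2 z hz z' hz'
  · exact continuous_of_uncurry hF
  · refine Subtype.ext (ContinuousMap.ext fun z => Subtype.ext (Prod.ext (e₀ z).1.symm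
      (ContinuousMap.ext fun t => ((e₀ z).2 t).symm)))
  · refine Subtype.ext (ContinuousMap.ext fun z => Subtype.ext (Prod.ext (e₁ z).1.symm
      (ContinuousMap.ext fun t => ((e₁ z).2 t).symm)))

end FreeCube

/-- A homotopy equivalence induces an equivalence of fundamental groupoids; this is fullness of that
functor. -/
theorem exists_path_map_homotopic {A B : Type} [TopologicalSpace A] [TopologicalSpace B]
    (f : C(A, B)) (hf : IsHtpyEquiv f) {a a' : A} (q : Path (f a) (f a')) :
    ∃ p : Path a a', (p.map f.continuous).Homotopic q := by
  obtain ⟨g, h₁, h₂⟩ := hf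
  have hfull := (FundamentalGroupoidFunctor.equivOfHomotopyEquiv ⟨f, g, h₁, h₂⟩).full_functor
  obtain ⟨p, hp⟩ := hfull.map_surjective (X := ⟨a⟩) (Y := ⟨a'⟩)
    (Path.Homotopic.Quotient.mk q : Path.Homotopic.Quotient (f a) (f a'))
  obtain ⟨p, rfl⟩ := Path.Homotopic.Quotient.mk_surjective p
  exact ⟨p, Path.Homotopic.Quotient.exact hp⟩

theorem IsHtpyEquiv.freeCube_map {X Y : Type} [TopologicalSpace X] [TopologicalSpace Y]
    {f : C(X, Y)} (hf : IsHtpyEquiv f) (m : ℕ) : IsHtpyEquiv (FreeCube.map m f) := by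
  obtain ⟨g, h₁, h₂⟩ := hf
  exact ⟨FreeCube.map m g, FreeCube.map_homotopic m h₁, FreeCube.map_homotopic m h₂⟩

/-- All free cubes in the homotopy fiber of a homotopy equivalence are homotopic to a constant. -/
theorem IsHtpyEquiv.joined_const {X Y : Type} [TopologicalSpace X] [TopologicalSpace Y]
    {f : C(X, Y)} (hf : IsHtpyEquiv f) (y : Y) : ∃ c : HoFiber f y, ∀ (m : ℕ)
    (γ : FreeCube m (HoFiber f y)), Joined γ (FreeCube.const m c) := by
  obtain ⟨g, h₁, ⟨H⟩⟩ := id hf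
  refine ⟨⟨(g y, ⟨fun t => H (t, y), by fun_prop⟩), H.apply_zero y, H.apply_one y⟩, fun m γ => ?_⟩
  let u : FreeCube m X := ⟨⟨fun z => (γ.1 z).1.1,
      (continuous_fst.comp continuous_subtype_val).comp γ.1.continuous⟩,
    fun z hz z' hz' => congrArg (fun p => p.1.1) (γ.2 z hz z' hz')⟩
  have hγ : Continuous fun z => (γ.1 z).1.2 :=
    (continuous_snd.comp continuous_subtype_val).comp γ.1.continuous
  let w : Path (FreeCube.map m f u) (FreeCube.const m y) :=
    { toFun t := ⟨⟨fun z => (γ.1 z).1.2 t, by fun_prop⟩,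
        fun z hz z' hz' => congrArg (fun p => p.1.2 t) (γ.2 z hz z' hz')⟩
      continuous_toFun := FreeCube.continuous_of_uncurry
        ((hγ.comp continuous_snd).eval continuous_fst)
      source' := Subtype.ext (ContinuousMap.ext fun z => (γ.1 z).2.1)
      target' := Subtype.ext (ContinuousMap.ext fun z => (γ.1 z).2.2) }
  let L : Path (FreeCube.map m f (FreeCube.const m (g y))) (FreeCube.const m y) :=
    { toFun t := FreeCube.const m (H (t, y))
      continuous_toFun := FreeCube.continuous_of_uncurry
        (H.continuous.comp (by fun_prop : Continuous fun p : I × (Fin m → I) => (p.1, y)))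
      source' := Subtype.ext (ContinuousMap.ext fun z => H.apply_zero y)
      target' := Subtype.ext (ContinuousMap.ext fun z => H.apply_one y) }
  -- The cube `γ` amounts to `u` and the path `w`, the constant cube to `g y` and `L`. A lift `θ` of
  -- `w` followed by the reverse of `L` connects the first components, and `w` is homotopic to the
  -- image of `θ` followed by `L`.
  obtain ⟨θ, hθ⟩ := exists_path_map_homotopic _ (hf.freeCube_map m) (w.trans L.symm)
  set v := (θ.map (FreeCube.map m f).continuous).trans L with hv
  have hwv : w.Homotopic v := by
    have h := congrArg (fun q => q.trans (Path.Homotopic.Quotient.mk L))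
      (Path.Homotopic.Quotient.eq.2 hθ)
    simp only [Path.Homotopic.Quotient.mk_trans, Path.Homotopic.Quotient.mk_symm,
      Path.Homotopic.Quotient.trans_assoc, Path.Homotopic.Quotient.symm_trans,
      Path.Homotopic.Quotient.trans_refl] at h
    rw [← Path.Homotopic.Quotient.mk_trans] at h
    exact (Path.Homotopic.Quotient.exact h).symm
  obtain ⟨G⟩ := hwv
  let γ' : FreeCube m (HoFiber f y) := ⟨⟨fun z => ⟨(u.1 z, ⟨fun t => (v t).1 z,
      FreeCube.continuous_eval v.continuous continuous_const⟩),
        congrArg (fun a : FreeCube m Y => a.1 z) v.source,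
        congrArg (fun a : FreeCube m Y => a.1 z) v.target⟩, by
      refine Continuous.subtype_mk (u.1.continuous.prodMk ?_) _
      refine ContinuousMap.continuous_of_continuous_uncurry _ ?_
      exact FreeCube.continuous_eval (v.continuous.comp continuous_snd) continuous_fst⟩,
    fun z hz z' hz' => Subtype.ext (Prod.ext (u.2 z hz z' hz') (ContinuousMap.ext fun t =>
      (v t).2 z hz z' hz'))⟩
  have j₁ : Joined γ γ' := by
    refine FreeCube.joined_hoFiber (ContinuousMap.const _ u) G.toContinuousMap
      (fun s => G.source s) (fun s => G.target s) γ γ' (fun z => ⟨rfl, fun t => ?_⟩)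
      (fun z => ⟨rfl, fun t => ?_⟩)
    · exact (congrArg (fun a : FreeCube m Y => a.1 z) (G.apply_zero t)).symm
    · exact (congrArg (fun a : FreeCube m Y => a.1 z) (G.apply_one t)).symm
  refine j₁.trans ?_
  -- `v ∘ r (s, ·)` is `v` on `[s/2, 1]`, reparametrized. While the first component moves along `θ`,
  -- the part of the image of `θ` already traversed is cut off from `v`. That image occupies the
  -- first half of `v`, so only `L` remains at `s = 1`.
  let r : C(I × I, I) := ⟨fun p => Set.projIcc 0 1 zero_le_one
    ((p.1 : ℝ) / 2 + p.2 * (1 - p.1 / 2)), by fun_prop⟩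
  have hr₀ : ∀ s : I, v (r (s, 0)) = FreeCube.map m f (θ s) := by
    intro s
    have : (r (s, 0) : ℝ) = s / 2 := by
      have := s.2.1
      have := s.2.2
      simp only [r, ContinuousMap.coe_mk, Set.coe_projIcc, Set.Icc.coe_zero, zero_mul, add_zero]
      rw [min_eq_right (by linarith), max_eq_right (by linarith)]
    have hs := s.2.2
    rw [hv, Path.trans_apply, dif_pos (by rw [this]; linarith)]
    simp only [Path.map_coe, Function.comp, this]
    congr 2
    exact Subtype.ext (by simp; ring)
  have hr₁ : ∀ t : I, v (r (1, t)) = L t := by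
    intro t
    have h0 := t.2.1
    have h1 := t.2.2
    have : (r (1, t) : ℝ) = 1 / 2 + t / 2 := by
      simp only [r, ContinuousMap.coe_mk, Set.coe_projIcc, Set.Icc.coe_one]
      rw [min_eq_right (by linarith), max_eq_right (by linarith)]
      ring
    rw [hv, Path.trans_apply]
    split_ifs with h
    · rw [this] at h
      have ht : t = 0 := Subtype.ext (by rw [Set.Icc.coe_zero]; linarith)
      subst ht
      refine Eq.trans ?_ ((θ.map (FreeCube.map m f).continuous).target.trans L.source.symm)
      exact congrArg (θ.map (FreeCube.map m f).continuous) (Subtype.ext (by simp [this]))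
    · congr 1
      exact Subtype.ext (by simp only [this]; ring)
  refine FreeCube.joined_hoFiber ⟨θ, θ.continuous⟩ ((⟨v, v.continuous⟩ : C(I, _)).comp r)
      hr₀ ?_ γ' _ (fun z => ⟨?_, fun t => ?_⟩) (fun z => ⟨?_, fun t => ?_⟩)
  · intro s
    have : r (s, 1) = 1 := Subtype.ext (by simp [r])
    simp [this]
  · exact congrArg (fun a : FreeCube m X => a.1 z) θ.source.symm
  · have : r (0, t) = t := by simp [r]
    exact congrArg (fun a => (v a).1 z) this.symm
  · simp; rfl
  · exact (congrArg (fun a : FreeCube m Y => a.1 z) (hr₁ t)).symm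

/-! ### From free to based null-homotopies -/

/-- The stretching of the unit interval about its midpoint, by the factor `1 + s`. -/
def stretch (s z : I) : I := Set.projIcc 0 1 zero_le_one ((z : ℝ) + s * (z - 1 / 2))

theorem continuous_stretch : Continuous fun p : I × I => stretch p.1 p.2 := by
  unfold stretch
  fun_prop

theorem stretch_zero_left (z : I) : stretch 0 z = z := by
  simp [stretch]

theorem stretch_zero (s : I) : stretch s 0 = 0 := by
  have := s.2.1
  refine Subtype.ext ?_
  simp only [stretch, Set.coe_projIcc, Set.Icc.coe_zero]
  rw [max_eq_left]
  exact min_le_of_right_le (by nlinarith)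

theorem stretch_one (s : I) : stretch s 1 = 1 := by
  have := s.2.1
  refine Subtype.ext ?_
  simp only [stretch, Set.coe_projIcc, Set.Icc.coe_one]
  rw [min_eq_left (by nlinarith), max_eq_right zero_le_one]

theorem stretch_mem_boundary {m : ℕ} (s : I) {z : Fin m → I} (hz : z ∈ Cube.boundary (Fin m)) :
    (fun i => stretch s (z i)) ∈ Cube.boundary (Fin m) := by
  obtain ⟨i, h | h⟩ := hz
  · exact ⟨i, Or.inl (by simp [h, stretch_zero])⟩
  · exact ⟨i, Or.inr (by simp [h, stretch_one])⟩

/-- A function on the interval that vanishes at the ends and is `1` on the middle half. -/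
def bump (z : I) : I := Set.projIcc 0 1 zero_le_one (min (4 * (z : ℝ)) (4 * (1 - z)))

theorem continuous_bump : Continuous bump := by
  unfold bump
  fun_prop

/-- The constants match: `stretch 1` collapses `[0, 1/4]` and `[3/4, 1]` to the ends, and `bump` is
`1` on the interval between them. -/
theorem stretch_of_bump_ne_one {z : I} (hz : bump z ≠ 1) : stretch 1 z = 0 ∨ stretch 1 z = 1 := by
  by_contra! h
  refine hz (Subtype.ext ?_)
  have h0 : 1 / 4 < (z : ℝ) := by
    by_contra! hle
    refine h.1 (Subtype.ext ?_)
    simp only [stretch, Set.coe_projIcc, Set.Icc.coe_zero, Set.Icc.coe_one]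
    rw [max_eq_left]
    exact min_le_of_right_le (by linarith)
  have h1 : (z : ℝ) < 3 / 4 := by
    by_contra! hle
    refine h.2 (Subtype.ext ?_)
    simp only [stretch, Set.coe_projIcc, Set.Icc.coe_one]
    rw [min_eq_left (by linarith), max_eq_right zero_le_one]
  simp only [bump, Set.coe_projIcc, Set.Icc.coe_one]
  rw [min_eq_left (le_min (by linarith) (by linarith)), max_eq_right zero_le_one]

/-- A function on the cube that vanishes on the boundary and is `1` on a smaller cube. -/
def cubeBump {m : ℕ} (z : Fin m → I) : I := ∏ i, bump (z i)

theorem continuous_cubeBump {m : ℕ} : Continuous (cubeBump (m := m)) :=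
  continuous_finsetProd _ fun i _ => continuous_bump.comp (continuous_apply i)

theorem cubeBump_eq_zero {m : ℕ} {z : Fin m → I} (hz : z ∈ Cube.boundary (Fin m)) :
    cubeBump z = 0 := by
  obtain ⟨i, h | h⟩ := hz
  all_goals
    refine Finset.prod_eq_zero (Finset.mem_univ i) (Subtype.ext ?_)
    simp [h, bump]

theorem stretch_of_cubeBump_ne_one {m : ℕ} {z : Fin m → I} (hz : cubeBump z ≠ 1) :
    (fun i => stretch 1 (z i)) ∈ Cube.boundary (Fin m) := by
  by_contra h
  refine hz (Finset.prod_eq_one fun i _ => ?_)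
  by_contra hi
  exact h ⟨i, stretch_of_bump_ne_one hi⟩

/-- In a free null-homotopy `N` the boundary value moves along a path from `x` to `c`. First `γ` is
shrunk to an inner cube with a collar at `x`; then `N` is run on the inner cube, while the collar
follows the track of the boundary value. The result factors through this track and is contracted
along it. In dimension `0` free cubes are points. -/
theorem weaklyContractible_of_joined_const {F : Type} [TopologicalSpace F] (c : F)
    (h : ∀ (m : ℕ) (γ : FreeCube m F), Joined γ (FreeCube.const m c)) : WeaklyContractible F := by
  refine ⟨⟨c⟩, fun m x => ?_⟩
  rcases m with _ | m
  · have hj : ∀ a : F, Joined a c := by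
      intro a
      obtain ⟨p⟩ := h 0 (FreeCube.const 0 a)
      refine ⟨⟨⟨fun t => (p t).1 default, FreeCube.continuous_eval p.continuous
        continuous_const⟩, ?_, ?_⟩⟩
      · simp; rfl
      · simp; rfl
    have : Subsingleton (ZerothHomotopy F) := by
      refine ⟨fun a b => ?_⟩
      induction a using Quotient.inductionOn
      induction b using Quotient.inductionOn
      exact Quotient.sound ((hj _).trans (hj _).symm)
    exact HomotopyGroup.pi0EquivZerothHomotopy.subsingleton
  · suffices hs : ∀ γ : GenLoop (Fin (m + 1)) F x, GenLoop.Homotopic γ GenLoop.const by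
      refine ⟨fun a b => ?_⟩
      induction a using Quotient.inductionOn
      induction b using Quotient.inductionOn
      exact Quotient.sound ((hs _).trans (hs _).symm)
    intro γ
    have hγ : ∀ z ∈ Cube.boundary (Fin (m + 1)), γ.1 z = x := γ.2
    let γ₀ : FreeCube (m + 1) F :=
      ⟨γ.1, fun z hz z' hz' => (hγ z hz).trans (hγ z' hz').symm⟩
    obtain ⟨N⟩ := h (m + 1) γ₀
    have hz₀ : (fun _ => 0 : Fin (m + 1) → I) ∈ Cube.boundary (Fin (m + 1)) := ⟨0, Or.inl rfl⟩
    have hst : Continuous fun p : I × (Fin (m + 1) → I) => fun i => stretch p.1 (p.2 i) :=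
      continuous_pi fun i => continuous_stretch.comp
        (by fun_prop : Continuous fun p : I × (Fin (m + 1) → I) => (p.1, p.2 i))
    have hst1 : Continuous fun z : (Fin (m + 1) → I) => fun i => stretch 1 (z i) :=
      hst.comp (by fun_prop : Continuous fun z : (Fin (m + 1) → I) => ((1 : I), z))
    have hN0 : ∀ z, (N 0).1 z = γ.1 z := by intro z; simp [γ₀]
    have hN1 : ∀ z, (N 1).1 z = c := by intro z; simp; rfl
    let γ₁ : C(Fin (m + 1) → I, F) := ⟨fun z => γ.1 fun i => stretch 1 (z i),
      γ.1.continuous.comp hst1⟩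
    let γ₂ : C(Fin (m + 1) → I, F) := ⟨fun z => (N (cubeBump z)).1 fun _ => 0,
      FreeCube.continuous_eval (N.continuous.comp continuous_cubeBump) continuous_const⟩
    have hγ₁ : ∀ z ∈ Cube.boundary (Fin (m + 1)), γ₁ z = x := fun z hz =>
      hγ _ (stretch_mem_boundary 1 hz)
    have hγ₂ : ∀ z ∈ Cube.boundary (Fin (m + 1)), γ₂ z = x := fun z hz => by
      simp only [γ₂, ContinuousMap.coe_mk, cubeBump_eq_zero hz, hN0]
      exact hγ _ hz₀
    have H₁ : γ.1.HomotopicRel γ₁ (Cube.boundary (Fin (m + 1))) := by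
      refine ⟨⟨⟨⟨fun p => γ.1 fun i => stretch p.1 (p.2 i), γ.1.continuous.comp hst⟩, ?_, ?_⟩, ?_⟩⟩
      · intro z; simp [stretch_zero_left]
      · intro z; rfl
      · intro s z hz
        exact (hγ _ (stretch_mem_boundary s hz)).trans (hγ z hz).symm
    -- Running `N` only up to `cubeBump z` keeps the boundary fixed. At the end, either `cubeBump z
    -- = 1` and both sides are `c`, or the stretched point is on the boundary, where `N` has the
    -- same value as at the corner.
    have H₂ : γ₁.HomotopicRel γ₂ (Cube.boundary (Fin (m + 1))) := by
      refine ⟨⟨⟨⟨fun p => (N (p.1 ⊓ cubeBump p.2)).1 fun i => stretch 1 (p.2 i), ?_⟩, ?_, ?_⟩, ?_⟩⟩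
      · exact FreeCube.continuous_eval (N.continuous.comp (continuous_fst.inf
          (continuous_cubeBump.comp continuous_snd))) (hst1.comp continuous_snd)
      · intro z
        dsimp only
        rw [inf_eq_left.2 (show (0 : I) ≤ cubeBump z from (cubeBump z).2.1), hN0]
        rfl
      · intro z
        simp only [ContinuousMap.coe_mk, γ₂]
        rw [inf_eq_right.2 (show cubeBump z ≤ 1 from (cubeBump z).2.2)]
        by_cases hz : cubeBump z = 1
        · rw [hz, hN1, hN1]
        · exact (N _).2 _ (stretch_of_cubeBump_ne_one hz) _ hz₀
      · intro s z hz
        simp only [ContinuousMap.coe_mk, cubeBump_eq_zero hz]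
        rw [inf_eq_right.2 (show 0 ≤ s from s.2.1), hN0]
        rfl
    have H₃ : γ₂.HomotopicRel (ContinuousMap.const _ x) (Cube.boundary (Fin (m + 1))) := by
      refine ⟨⟨⟨⟨fun p => (N (cubeBump p.2 * σ p.1)).1 fun _ => 0, ?_⟩, ?_, ?_⟩, ?_⟩⟩
      · exact FreeCube.continuous_eval (N.continuous.comp ((continuous_cubeBump.comp
          continuous_snd).mul (continuous_symm.comp continuous_fst))) continuous_const
      · intro z; simp [γ₂]
      · intro z
        simp only [symm_one, mul_zero, hN0]
        exact hγ _ hz₀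
      · intro s z hz
        simp only [ContinuousMap.coe_mk, cubeBump_eq_zero hz, zero_mul, hN0, γ₂]
    exact (H₁.trans H₂).trans H₃

theorem IsHtpyEquiv.isWeakEquiv {X Y : Type} [TopologicalSpace X] [TopologicalSpace Y]
    {f : C(X, Y)} (hf : IsHtpyEquiv f) : IsWeakEquiv f := fun y => by
  obtain ⟨c, hc⟩ := hf.joined_const y
  exact weaklyContractible_of_joined_const c hc

/-! ### Dragging a point along moving obstacles -/

theorem sInf_image_univ_le {K : Type} [TopologicalSpace K] [CompactSpace K] {F : K → ℝ}
    (hF : Continuous F) (x : K) : sInf (F '' Set.univ) ≤ F x :=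
  csInf_le (isCompact_univ.image hF).bddBelow (Set.mem_image_of_mem F (Set.mem_univ x))

theorem sInf_image_univ_pos {K : Type} [TopologicalSpace K] [CompactSpace K] [Nonempty K]
    {F : K → ℝ} (hF : Continuous F) (h : ∀ x, 0 < F x) : 0 < sInf (F '' Set.univ) := by
  obtain ⟨x, -, hx⟩ := isCompact_univ.exists_sInf_image_eq Set.univ_nonempty hF.continuousOn
  rw [hx]
  exact h x

theorem prod_univ_le_of_le_one {J : Type} [Fintype J] {f : J → ℝ} (h₀ : ∀ j, 0 ≤ f j)
    (h₁ : ∀ j, f j ≤ 1) (j : J) : ∏ i, f i ≤ f j := by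
  classical
  rw [← Finset.mul_prod_erase _ _ (Finset.mem_univ j)]
  exact mul_le_of_le_one_right (h₀ j) (Finset.prod_le_one (fun i _ => h₀ i) fun i _ => h₁ i)

namespace Drag

set_option linter.unusedSectionVars false

variable {J E : Type} [Fintype J] [DecidableEq J] [NormedAddCommGroup E]

/-- A measure of the distance of the obstacles `j` and `l` at time `s`. The obstacle `j` counts as
present to the extent `u j`; if one of the two is absent, the value is `1`. -/
def gap (a : J → C(I, E)) (u : J → ℝ) (s : I) (q : J × J) : ℝ :=
  if q.1 = q.2 then 1 else min 1 (‖a q.1 s - a q.2 s‖ + |1 - u q.1| + |1 - u q.2|)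

/-- A radius such that balls of this radius around present obstacles are disjoint at all times. -/
def radius (a : J → C(I, E)) (u : J → ℝ) : ℝ :=
  sInf ((fun s => ∏ q, gap a u s q) '' Set.univ) / 2

/-- A measure of the speed of the obstacle `j` between the times `p.1` and `p.2`. -/
def slowness (a : J → C(I, E)) (u : J → ℝ) (p : I × I) (j : J) : ℝ :=
  min 1 (|1 - u j| + |(p.1 : ℝ) - p.2| +
    max 0 (radius a u - (Fintype.card J + 1) * ‖a j p.1 - a j p.2‖))

/-- A duration in which present obstacles move very little, compared to the radius. -/
def step (a : J → C(I, E)) (u : J → ℝ) : ℝ :=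
  sInf ((fun p => ∏ j, slowness a u p j) '' Set.univ) / 2

theorem gap_nonneg (a : J → C(I, E)) (u : J → ℝ) (s : I) (q : J × J) : 0 ≤ gap a u s q := by
  unfold gap
  split_ifs <;> positivity

theorem gap_le_one (a : J → C(I, E)) (u : J → ℝ) (s : I) (q : J × J) : gap a u s q ≤ 1 := by
  unfold gap
  split_ifs
  · exact le_rfl
  · exact min_le_left _ _

theorem slowness_nonneg (a : J → C(I, E)) (u : J → ℝ) (p : I × I) (j : J) :
    0 ≤ slowness a u p j := by
  unfold slowness
  positivity

theorem slowness_le_one (a : J → C(I, E)) (u : J → ℝ) (p : I × I) (j : J) :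
    slowness a u p j ≤ 1 := min_le_left _ _

theorem continuous_gap {A : Type} [TopologicalSpace A] {a : A → J → C(I, E)} {u : A → J → ℝ}
    {s : A → I} (ha : Continuous a) (hu : Continuous u) (hs : Continuous s) (q : J × J) :
    Continuous fun x => gap (a x) (u x) (s x) q := by
  unfold gap
  split_ifs
  · exact continuous_const
  · have h₁ : Continuous fun x => a x q.1 (s x) := ((continuous_apply q.1).comp ha).eval hs
    have h₂ : Continuous fun x => a x q.2 (s x) := ((continuous_apply q.2).comp ha).eval hs
    fun_prop

theorem continuous_radius {A : Type} [TopologicalSpace A] {a : A → J → C(I, E)} {u : A → J → ℝ}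
    (ha : Continuous a) (hu : Continuous u) : Continuous fun x => radius (a x) (u x) := by
  refine Continuous.div_const (isCompact_univ.continuous_sInf
    (f := fun x s => ∏ q, gap (a x) (u x) s q) ?_) 2
  exact continuous_finsetProd _ fun q _ =>
    continuous_gap (ha.comp continuous_fst) (hu.comp continuous_fst) continuous_snd q

theorem continuous_slowness {A : Type} [TopologicalSpace A] {a : A → J → C(I, E)} {u : A → J → ℝ}
    {p : A → I × I} (ha : Continuous a) (hu : Continuous u) (hp : Continuous p) (j : J) :
    Continuous fun x => slowness (a x) (u x) (p x) j := by
  unfold slowness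
  have h₁ : Continuous fun x => a x j (p x).1 :=
    ((continuous_apply j).comp ha).eval (continuous_fst.comp hp)
  have h₂ : Continuous fun x => a x j (p x).2 :=
    ((continuous_apply j).comp ha).eval (continuous_snd.comp hp)
  have h₃ := continuous_radius ha hu
  fun_prop

theorem continuous_step {A : Type} [TopologicalSpace A] {a : A → J → C(I, E)} {u : A → J → ℝ}
    (ha : Continuous a) (hu : Continuous u) : Continuous fun x => step (a x) (u x) := by
  refine Continuous.div_const (isCompact_univ.continuous_sInf
    (f := fun x p => ∏ j, slowness (a x) (u x) p j) ?_) 2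
  exact continuous_finsetProd _ fun j _ =>
    continuous_slowness (ha.comp continuous_fst) (hu.comp continuous_fst) continuous_snd j

/-- The present obstacles are pairwise distinct at all times. -/
def Valid (a : J → C(I, E)) (u : J → ℝ) : Prop :=
  ∀ j l, u j ≠ 0 → u l ≠ 0 → j ≠ l → ∀ s, a j s ≠ a l s

theorem Valid.radius_pos {a : J → C(I, E)} {u : J → ℝ} (h : Valid a u) : 0 < radius a u := by
  refine half_pos (sInf_image_univ_pos ?_ fun s => Finset.prod_pos fun q _ => ?_)
  · exact continuous_finsetProd _ fun q _ =>
      continuous_gap continuous_const continuous_const continuous_id q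
  · unfold gap
    split_ifs with hq
    · exact one_pos
    · refine lt_min one_pos ?_
      by_cases h₁ : u q.1 = 0
      · rw [h₁, sub_zero, abs_one]
        positivity
      · by_cases h₂ : u q.2 = 0
        · rw [h₂, sub_zero, abs_one]
          positivity
        · have := norm_pos_iff.2 (sub_ne_zero.2 (h q.1 q.2 h₁ h₂ hq s))
          positivity

/-- Either the two times differ, or the obstacle has not moved between them and the last summand of
`slowness` is the radius. -/
theorem Valid.step_pos {a : J → C(I, E)} {u : J → ℝ} (h : Valid a u) : 0 < step a u := by
  refine half_pos (sInf_image_univ_pos ?_ fun p => Finset.prod_pos fun j _ => ?_)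
  · exact continuous_finsetProd _ fun j _ =>
      continuous_slowness continuous_const continuous_const continuous_id j
  · refine lt_min one_pos ?_
    by_cases hp : p.1 = p.2
    · rw [hp, sub_self, sub_self, norm_zero, mul_zero, sub_zero]
      have : 0 < max 0 (radius a u) := lt_max_of_lt_right h.radius_pos
      positivity
    · have : 0 < |(p.1 : ℝ) - p.2| := abs_pos.2 (sub_ne_zero.2 fun h => hp (Subtype.ext h))
      positivity

theorem two_radius_le (a : J → C(I, E)) {u : J → ℝ} {j l : J} (hj : u j = 1) (hl : u l = 1)
    (hjl : j ≠ l) (s : I) : 2 * radius a u ≤ ‖a j s - a l s‖ := by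
  have h₁ : 2 * radius a u ≤ ∏ q, gap a u s q := by
    rw [radius, mul_div_cancel₀ _ two_ne_zero]
    exact sInf_image_univ_le (F := fun s => ∏ q, gap a u s q) (continuous_finsetProd _ fun q _ =>
      continuous_gap continuous_const continuous_const continuous_id q) s
  refine (h₁.trans (prod_univ_le_of_le_one (gap_nonneg a u s) (gap_le_one a u s) (j, l))).trans ?_
  rw [gap, if_neg hjl]
  refine (min_le_right _ _).trans (by simp [hj, hl])

/-- If the obstacle moved too far, the last summand of `slowness` would vanish, leaving at most `|s
- t| ≤ step`; but `slowness` is at least `2 * step`. This replaces a choice of modulus of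
continuity. -/
theorem lt_radius (a : J → C(I, E)) {u : J → ℝ} {j : J} (hj : u j = 1)
    {s t : I} (hst : |(s : ℝ) - t| ≤ step a u) (hpos : 0 < step a u) :
    (Fintype.card J + 1) * ‖a j s - a j t‖ < radius a u := by
  have h₁ : 2 * step a u ≤ ∏ j, slowness a u (s, t) j := by
    rw [step, mul_div_cancel₀ _ two_ne_zero]
    exact sInf_image_univ_le (F := fun p => ∏ j, slowness a u p j) (continuous_finsetProd _
      fun q _ => continuous_slowness continuous_const continuous_const continuous_id q) (s, t)
  have h₂ := h₁.trans (prod_univ_le_of_le_one (slowness_nonneg a u (s, t))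
    (slowness_le_one a u (s, t)) j)
  by_contra! hc
  rw [slowness, max_eq_left (by linarith)] at h₂
  have h₃ := h₂.trans (min_le_right _ _)
  simp only [hj, sub_self, abs_zero, zero_add, add_zero] at h₃
  linarith

/-- If an obstacle is absent, the summand `|1 - u|` is `1` and the minimum cuts off everything else,
so its path is irrelevant. This is the source of the compatibility with forgetting points. -/
theorem gap_congr {a a' : J → C(I, E)} {u : J → ℝ} (h : ∀ j, u j ≠ 0 → a j = a' j) (s : I)
    (q : J × J) : gap a u s q = gap a' u s q := by
  unfold gap
  split_ifs
  · rfl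
  by_cases h₁ : u q.1 = 0
  · rw [h₁, sub_zero, abs_one, min_eq_left (le_add_of_le_of_nonneg
      (le_add_of_nonneg_left (norm_nonneg _)) (abs_nonneg _)), min_eq_left (le_add_of_le_of_nonneg
      (le_add_of_nonneg_left (norm_nonneg _)) (abs_nonneg _))]
  by_cases h₂ : u q.2 = 0
  · rw [h₂, sub_zero, abs_one, min_eq_left (le_add_of_nonneg_left (by positivity)),
      min_eq_left (le_add_of_nonneg_left (by positivity))]
  rw [h _ h₁, h _ h₂]

theorem radius_congr {a a' : J → C(I, E)} {u : J → ℝ} (h : ∀ j, u j ≠ 0 → a j = a' j) :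
    radius a u = radius a' u := by
  simp only [radius, gap_congr h]

theorem step_congr {a a' : J → C(I, E)} {u : J → ℝ} (h : ∀ j, u j ≠ 0 → a j = a' j) :
    step a u = step a' u := by
  have : ∀ p j, slowness a u p j = slowness a' u p j := by
    intro p j
    by_cases h₁ : u j = 0
    · rw [slowness, slowness, h₁, sub_zero, abs_one, min_eq_left, min_eq_left]
      · rw [add_assoc]
        exact le_add_of_nonneg_right (by positivity)
      · rw [add_assoc]
        exact le_add_of_nonneg_right (by positivity)
    · rw [slowness, slowness, h j h₁, radius_congr h]
  simp only [step, this]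

/-! ### One small move of the obstacles -/

variable [NormedSpace ℝ E]

/-- The displacement of the point `x` caused by moving the obstacles from `c` to `c'`. The obstacle
`j` acts with strength `v j` on points at distance less than `r`. -/
def push (r : ℝ) (v : J → ℝ) (c c' : J → E) (x : E) : E :=
  x + ∑ j, (v j * max 0 (1 - ‖x - c j‖ / r)) • (c' j - c j)

theorem push_self (r : ℝ) (v : J → ℝ) (c : J → E) (x : E) : push r v c c x = x := by
  simp [push]

theorem push_congr {r : ℝ} {v : J → ℝ} {c c' d d' : J → E} (h : ∀ j, v j ≠ 0 → c j = d j)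
    (h' : ∀ j, v j ≠ 0 → c' j = d' j) (x : E) : push r v c c' x = push r v d d' x := by
  refine congrArg (x + ·) (Finset.sum_congr rfl fun j _ => ?_)
  by_cases hj : v j = 0
  · simp [hj]
  · rw [h j hj, h' j hj]

theorem continuous_push {A : Type} [TopologicalSpace A] {r : A → ℝ} {v : A → J → ℝ}
    {c c' : A → J → E} {x : A → E} (hr : Continuous r) (hr₀ : ∀ p, r p ≠ 0) (hv : Continuous v)
    (hc : Continuous c) (hc' : Continuous c') (hx : Continuous x) :
    Continuous fun p => push (r p) (v p) (c p) (c' p) (x p) := by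
  refine hx.add (continuous_finsetSum _ fun j _ => ?_)
  have h₁ := (continuous_apply j).comp hv
  have h₂ := (continuous_apply j).comp hc
  have h₃ := (continuous_apply j).comp hc'
  have h₄ : Continuous fun p => ‖x p - c p j‖ / r p := (hx.sub h₂).norm.div hr hr₀
  exact (h₁.mul (continuous_const.max (continuous_const.sub h₄))).smul (h₃.sub h₂)

/-- Within distance `r` of `c l` no other obstacle acts, and hitting `c' l` would force `‖c' l - c
l‖ = r`, which is too much. Farther away, the displacement of `x` and that of the obstacle `l`
amount to less than `card J + 1` times `r / (card J + 1)`, hence to less than `r`. -/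
theorem push_ne {r : ℝ} (hr : 0 < r) {v : J → ℝ} (hv₀ : ∀ j, 0 ≤ v j) (hv₁ : ∀ j, v j ≤ 1)
    {c c' : J → E} (hc : ∀ j, v j ≠ 0 → (Fintype.card J + 1) * ‖c j - c' j‖ < r) {l : J}
    (hl : v l = 1) (hcl : ∀ j, v j ≠ 0 → j ≠ l → 2 * r ≤ ‖c j - c l‖) {x : E} (hx : x ≠ c l) :
    push r v c c' x ≠ c' l := by
  intro he
  have hl₀ : v l ≠ 0 := by rw [hl]; exact one_ne_zero
  have hcard : (0 : ℝ) ≤ Fintype.card J := Nat.cast_nonneg _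
  rcases lt_or_ge ‖x - c l‖ r with hlt | hge
  · have hsum : ∑ j, (v j * max 0 (1 - ‖x - c j‖ / r)) • (c' j - c j) =
        (1 - ‖x - c l‖ / r) • (c' l - c l) := by
      rw [Finset.sum_eq_single l]
      · rw [hl, one_mul, max_eq_right]
        rw [sub_nonneg, div_le_one hr]
        exact hlt.le
      · intro j _ hj
        by_cases hvj : v j = 0
        · simp [hvj]
        · rw [max_eq_left, mul_zero, zero_smul]
          rw [sub_nonpos, one_le_div hr]
          have h₁ := hcl j hvj hj
          have h₂ : ‖c j - c l‖ ≤ ‖x - c j‖ + ‖x - c l‖ := by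
            rw [← norm_sub_rev (c j) x]
            exact norm_sub_le_norm_sub_add_norm_sub _ _ _
          linarith
      · intro h
        exact absurd (Finset.mem_univ l) h
    rw [push, hsum] at he
    have h₁ : x - c l = (‖x - c l‖ / r) • (c' l - c l) := by
      have : x = c' l - (1 - ‖x - c l‖ / r) • (c' l - c l) := eq_sub_of_add_eq he
      conv_lhs => rw [this]
      module
    have h₂ : ‖x - c l‖ = ‖x - c l‖ / r * ‖c' l - c l‖ := by
      conv_lhs => rw [h₁, norm_smul, norm_div, norm_norm, Real.norm_of_nonneg hr.le]
    have h₃ : 0 < ‖x - c l‖ := norm_pos_iff.2 (sub_ne_zero.2 hx)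
    have h₄ := hc l hl₀
    rw [norm_sub_rev] at h₄
    have h₅ : ‖c' l - c l‖ < r := by nlinarith [norm_nonneg (c' l - c l)]
    rw [div_mul_eq_mul_div, eq_div_iff hr.ne'] at h₂
    exact absurd (mul_left_cancel₀ h₃.ne' h₂) h₅.ne'
  · have hsum : ‖∑ j, (v j * max 0 (1 - ‖x - c j‖ / r)) • (c' j - c j)‖ ≤
        ∑ j : J, r / (Fintype.card J + 1) := by
      refine norm_sum_le_of_le _ fun j _ => ?_
      by_cases hvj : v j = 0
      · simp only [hvj, zero_mul, zero_smul, norm_zero]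
        positivity
      · rw [norm_smul, norm_sub_rev (c' j), le_div_iff₀ (by positivity), Real.norm_of_nonneg
          (mul_nonneg (hv₀ j) (le_max_left _ _))]
        have h₁ : v j * max 0 (1 - ‖x - c j‖ / r) ≤ 1 := by
          refine mul_le_one₀ (hv₁ j) (le_max_left _ _) (max_le zero_le_one ?_)
          rw [sub_le_self_iff]
          positivity
        have h₂ := hc j hvj
        have h₃ := mul_le_of_le_one_left (norm_nonneg (c j - c' j)) h₁
        nlinarith
    have h₁ := hc l hl₀
    have h₂ : ‖x - c l‖ ≤ ‖c l - c' l‖ +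
        ‖∑ j, (v j * max 0 (1 - ‖x - c j‖ / r)) • (c' j - c j)‖ := by
      have : x - c l = -(c l - c' l) -
          ∑ j, (v j * max 0 (1 - ‖x - c j‖ / r)) • (c' j - c j) := by
        rw [push] at he
        rw [← he]
        abel
      rw [this]
      exact (norm_sub_le _ _).trans (by rw [norm_neg])
    rw [Finset.sum_const, Finset.card_univ, nsmul_eq_mul] at hsum
    have h₃ : ‖c l - c' l‖ < r / (Fintype.card J + 1) := by
      rw [lt_div_iff₀ (by positivity), mul_comm]
      exact h₁
    have h₄ : r / (Fintype.card J + 1) + Fintype.card J * (r / (Fintype.card J + 1)) = r := by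
      field_simp
      ring
    linarith

/-! ### Composition of small moves -/

/-- The `m`-th time of the subdivision of `[0, s]` into intervals of length `h`. -/
def time (h : ℝ) (s : I) (m : ℕ) : I := Set.projIcc 0 1 zero_le_one (min (m * h) s)

theorem time_zero (h : ℝ) (s : I) : time h s 0 = 0 := by
  refine Subtype.ext ?_
  have := s.2.1
  simp [time, this]

theorem time_eq {h : ℝ} {s : I} {m : ℕ} (hm : 1 ≤ m * h) : time h s m = s := by
  rw [time, min_eq_right (s.2.2.trans hm), Set.projIcc_val]

theorem time_zero_right {h : ℝ} (hh : 0 < h) (m : ℕ) : time h 0 m = 0 := by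
  refine Subtype.ext ?_
  have : 0 ≤ m * h := by positivity
  simp [time, this]

theorem abs_time_sub_le {h : ℝ} (hh : 0 < h) (s : I) (m : ℕ) :
    |(time h s m : ℝ) - time h s (m + 1)| ≤ h := by
  have key : ∀ m : ℕ, (time h s m : ℝ) = min (m * h) s := by
    intro m
    have h₁ : 0 ≤ min (m * h) (s : ℝ) := le_min (by positivity) s.2.1
    have h₂ : min (m * h) (s : ℝ) ≤ 1 := (min_le_right _ _).trans s.2.2
    simp only [time, Set.coe_projIcc, min_eq_right h₂, max_eq_right h₁]
  rw [key, key]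
  push_cast
  refine (abs_min_sub_min_le_max _ _ _ _).trans ?_
  rw [sub_self, abs_zero, max_eq_left (abs_nonneg _), add_mul, one_mul, sub_add_cancel_left,
    abs_neg, abs_of_pos hh]

/-- The position of the point `x` after the first `m` moves of the obstacles. -/
def iter (a : J → C(I, E)) (u v : J → ℝ) (s : I) (x : E) : ℕ → E
  | 0 => x
  | m + 1 => push (radius a u) v (fun j => a j (time (step a u) s m))
      (fun j => a j (time (step a u) s (m + 1))) (iter a u v s x m)

theorem iter_congr {a a' : J → C(I, E)} {u v : J → ℝ} (h : ∀ j, u j ≠ 0 → a j = a' j)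
    (huv : ∀ j, v j ≠ 0 → u j = 1) (s : I) (x : E) (m : ℕ) :
    iter a u v s x m = iter a' u v s x m := by
  have hv : ∀ j, v j ≠ 0 → a j = a' j := fun j hj => h j (by simp [huv j hj])
  induction m with
  | zero => rfl
  | succ m ih =>
    rw [iter, iter, ih, radius_congr h, step_congr h]
    exact push_congr (fun j hj => by rw [hv j hj]) (fun j hj => by rw [hv j hj]) _

theorem continuous_iter {A : Type} [TopologicalSpace A] {a : A → J → C(I, E)} {u v : A → J → ℝ}
    {s : A → I} {x : A → E} (ha : Continuous a) (hu : Continuous u) (hv : Continuous v)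
    (hs : Continuous s) (hx : Continuous x) (h : ∀ p, Valid (a p) (u p)) (m : ℕ) :
    Continuous fun p => iter (a p) (u p) (v p) (s p) (x p) m := by
  have ht : ∀ m, Continuous fun p => time (step (a p) (u p)) (s p) m := by
    intro m
    have := continuous_step ha hu
    unfold time
    fun_prop
  have hat : ∀ m, Continuous fun p => fun j => a p j (time (step (a p) (u p)) (s p) m) :=
    fun m => continuous_pi fun j => ((continuous_apply j).comp ha).eval (ht m)
  induction m with
  | zero => exact hx
  | succ m ih =>
    exact continuous_push (continuous_radius ha hu) (fun p => (h p).radius_pos.ne')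
      hv (hat m) (hat (m + 1)) ih

theorem iter_ne {a : J → C(I, E)} {u v : J → ℝ} (h : Valid a u) (huv : ∀ j, v j ≠ 0 → u j = 1)
    (hv₀ : ∀ j, 0 ≤ v j) (hv₁ : ∀ j, v j ≤ 1) {l : J} (hl : v l = 1) {x : E} (hx : x ≠ a l 0)
    (s : I) (m : ℕ) : iter a u v s x m ≠ a l (time (step a u) s m) := by
  induction m with
  | zero => simpa only [iter, time_zero] using hx
  | succ m ih =>
    rw [iter]
    refine push_ne h.radius_pos hv₀ hv₁ (fun j hj => ?_) hl (fun j hj hjl => ?_) ih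
    · exact lt_radius a (huv j hj) (abs_time_sub_le h.step_pos s m) h.step_pos
    · exact two_radius_le a (huv j hj) (huv l (by simp [hl])) hjl _

/-- Once the subdivision has reached `s`, all further moves are trivial. So any sufficiently large
number of moves gives the same position. -/
theorem iter_eq_of_le {a : J → C(I, E)} {u v : J → ℝ} (s : I) (x : E) {m m' : ℕ} (hm : m ≤ m')
    (hpos : 0 < step a u) (h : 1 ≤ m * step a u) : iter a u v s x m' = iter a u v s x m := by
  induction m', hm using Nat.le_induction with
  | base => rfl
  | succ m' hm ih =>
    have h₁ : (m : ℝ) * step a u ≤ m' * step a u := by gcongr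
    have h₂ : (m' : ℝ) * step a u ≤ (m' + 1 : ℕ) * step a u := by gcongr; simp
    rw [iter, ih, time_eq (h.trans h₁), time_eq (h.trans (h₁.trans h₂)), push_self]

/-- The position at time `s` of the point `x`, dragged along by the obstacles. -/
def drag (a : J → C(I, E)) (u v : J → ℝ) (s : I) (x : E) : E :=
  iter a u v s x ⌈1 / step a u⌉₊

theorem one_le_ceil_mul {h : ℝ} (hh : 0 < h) : 1 ≤ (⌈1 / h⌉₊ : ℝ) * h := by
  rw [← div_le_iff₀ hh]
  exact Nat.le_ceil _

theorem drag_eq_iter {a : J → C(I, E)} {u v : J → ℝ} (s : I) (x : E) {m : ℕ} (h : Valid a u)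
    (hm : 1 / step a u ≤ m) : drag a u v s x = iter a u v s x m :=
  (iter_eq_of_le s x (Nat.ceil_le.2 hm) h.step_pos (one_le_ceil_mul h.step_pos)).symm

theorem drag_congr {a a' : J → C(I, E)} {u v : J → ℝ} (h : ∀ j, u j ≠ 0 → a j = a' j)
    (huv : ∀ j, v j ≠ 0 → u j = 1) (s : I) (x : E) : drag a u v s x = drag a' u v s x := by
  rw [drag, drag, iter_congr h huv, step_congr h]

theorem drag_ne {a : J → C(I, E)} {u v : J → ℝ} (h : Valid a u) (huv : ∀ j, v j ≠ 0 → u j = 1)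
    (hv₀ : ∀ j, 0 ≤ v j) (hv₁ : ∀ j, v j ≤ 1) {l : J} (hl : v l = 1) {x : E} (hx : x ≠ a l 0)
    (s : I) : drag a u v s x ≠ a l s := by
  have := iter_ne h huv hv₀ hv₁ hl hx s ⌈1 / step a u⌉₊
  rwa [time_eq (one_le_ceil_mul h.step_pos)] at this

theorem drag_zero {a : J → C(I, E)} {u v : J → ℝ} (h : Valid a u) (x : E) :
    drag a u v 0 x = x := by
  have : ∀ m, iter a u v 0 x m = x := by
    intro m
    induction m with
    | zero => rfl
    | succ m ih => rw [iter, ih, time_zero_right h.step_pos, time_zero_right h.step_pos, push_self]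
  exact this _

theorem drag_of_const {a : J → C(I, E)} {u v : J → ℝ} (ha : ∀ j s, a j s = a j 0) (s : I) (x : E) :
    drag a u v s x = x := by
  have : ∀ m, iter a u v s x m = x := by
    intro m
    induction m with
    | zero => rfl
    | succ m ih =>
      simp only [iter, ih]
      simp only [ha _ (time _ _ _)]
      exact push_self _ _ _ _
  exact this _

/-- The number of moves in `drag` jumps, but near a given parameter one fixed larger number computes
the same position, and `iter` with a fixed number of moves is continuous. -/
theorem continuous_drag {A : Type} [TopologicalSpace A] {a : A → J → C(I, E)} {u v : A → J → ℝ}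
    {s : A → I} {x : A → E} (ha : Continuous a) (hu : Continuous u) (hv : Continuous v)
    (hs : Continuous s) (hx : Continuous x) (h : ∀ p, Valid (a p) (u p)) :
    Continuous fun p => drag (a p) (u p) (v p) (s p) (x p) := by
  rw [continuous_iff_continuousAt]
  intro p
  have hc : Continuous fun p => 1 / step (a p) (u p) :=
    continuous_const.div (continuous_step ha hu) fun p => (h p).step_pos.ne'
  obtain ⟨m, hm⟩ := exists_nat_gt (1 / step (a p) (u p))
  refine ((continuous_iter ha hu hv hs hx h m).continuousAt).congr ?_
  filter_upwards [hc.continuousAt.eventually (gt_mem_nhds hm)] with q hq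
  exact (drag_eq_iter _ _ (h q) hq.le).symm

end Drag

/-! ### Maps out of homotopy colimits of punctured cubes -/

namespace FaceSimplex

variable {ι : Type} [Fintype ι]

/-- The point `(1 - s) t + s t'` of the segment from `t` to `t'`. -/
def segment {S : Finset ι} (s : I) (t t' : FaceSimplex S) : FaceSimplex S :=
  ⟨(1 - (s : ℝ)) • t.1 + (s : ℝ) • t'.1,
    convex_stdSimplex ℝ ι t.2.1 t'.2.1 (sub_nonneg.2 s.2.2) s.2.1 (sub_add_cancel _ _),
    fun j hj => by simp [t.2.2 j hj, t'.2.2 j hj]⟩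

theorem continuous_val {S : Finset ι} : Continuous fun t : FaceSimplex S => t.1 :=
  continuous_subtype_val

theorem continuous_segment {S : Finset ι} {A : Type} [TopologicalSpace A] {s : A → I}
    {t t' : A → FaceSimplex S} (hs : Continuous s) (ht : Continuous t) (ht' : Continuous t') :
    Continuous fun a => segment (s a) (t a) (t' a) := by
  have h := continuous_val.comp ht
  have h' := continuous_val.comp ht'
  refine Continuous.subtype_mk ?_ _
  exact ((continuous_const.sub (continuous_subtype_val.comp hs)).smul h).add
    ((continuous_subtype_val.comp hs).smul h')

theorem segment_zero {S : Finset ι} (t t' : FaceSimplex S) : segment 0 t t' = t :=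
  Subtype.ext (by simp [segment])

theorem segment_one {S : Finset ι} (t t' : FaceSimplex S) : segment 1 t t' = t' :=
  Subtype.ext (by simp [segment])

/-- The map of faces induced by a map of the standard simplex that preserves faces. -/
def reweight {r : (ι → ℝ) → ι → ℝ}
    (hr : ∀ t ∈ stdSimplex ℝ ι, r t ∈ stdSimplex ℝ ι ∧ ∀ j, t j = 0 → r t j = 0)
    {S : Finset ι} (t : FaceSimplex S) : FaceSimplex S :=
  ⟨r t.1, (hr t.1 t.2.1).1, fun j hj => (hr t.1 t.2.1).2 j (t.2.2 j hj)⟩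

theorem continuous_reweight {r : (ι → ℝ) → ι → ℝ}
    (hr : ∀ t ∈ stdSimplex ℝ ι, r t ∈ stdSimplex ℝ ι ∧ ∀ j, t j = 0 → r t j = 0)
    (hc : ContinuousOn r (stdSimplex ℝ ι)) (S : Finset ι) :
    Continuous fun t : FaceSimplex S => t.reweight hr := by
  refine Continuous.subtype_mk ?_ _
  exact hc.comp_continuous continuous_val fun t => t.2.1

end FaceSimplex

namespace TopCube

variable {ι : Type} [Fintype ι] (X : TopCube ι)

/-- The point of the homotopy colimit represented by a point of one of the spaces. -/
def hocolimMk (S : {S : Finset ι // S ≠ Finset.univ}) (x : X.obj S.1) (t : FaceSimplex S.1) :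
    X.Hocolim := Quot.mk _ ⟨S, (x, t)⟩

theorem continuous_hocolimMk (S : {S : Finset ι // S ≠ Finset.univ}) :
    Continuous fun p : X.obj S.1 × FaceSimplex S.1 => X.hocolimMk S p.1 p.2 :=
  continuous_quot_mk.comp (@continuous_sigmaMk _
    (fun S : {S : Finset ι // S ≠ Finset.univ} => X.obj S.1 × FaceSimplex S.1) _ S)

variable {X}

theorem hocolimMk_glue {S T : {S : Finset ι // S ≠ Finset.univ}} (h : S.1 ⊆ T.1) (x : X.obj S.1)
    (t : FaceSimplex S.1) (t' : FaceSimplex T.1) (ht : t.1 = t'.1) :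
    X.hocolimMk S x t = X.hocolimMk T (X.arrow h x) t' := by
  obtain rfl : t = t'.incl h := Subtype.ext ht
  exact Quot.sound (HocolimRel.glue S T h x t')

theorem hocolimMk_congr {S : {S : Finset ι // S ≠ Finset.univ}} {x x' : X.obj S.1}
    {t t' : FaceSimplex S.1} (hx : x = x') (ht : t.1 = t'.1) :
    X.hocolimMk S x t = X.hocolimMk S x' t' := by
  rw [hx, Subtype.ext ht]

theorem hocolim_induction {p : X.Hocolim → Prop} (h : ∀ S x t, p (X.hocolimMk S x t)) (q) :
    p q := by
  induction q using Quot.inductionOn with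
  | h q => exact h q.1 q.2.1 q.2.2

variable {Z : Type} [TopologicalSpace Z]

/-- A map out of the homotopy colimit. -/
def hocolimLift (F : ∀ S : {S : Finset ι // S ≠ Finset.univ}, X.obj S.1 → FaceSimplex S.1 → Z)
    (hF : ∀ S, Continuous fun p : X.obj S.1 × FaceSimplex S.1 => F S p.1 p.2)
    (glue : ∀ (S T : {S : Finset ι // S ≠ Finset.univ}) (h : S.1 ⊆ T.1) (x : X.obj S.1)
      (t : FaceSimplex T.1), F S x (t.incl h) = F T (X.arrow h x) t) : C(X.Hocolim, Z) where
  toFun := Quot.lift (fun p : X.PreHocolim => F p.1 p.2.1 p.2.2) (by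
    rintro _ _ ⟨S, T, h, x, t⟩
    exact glue S T h x t)
  continuous_toFun := continuous_quot_lift _ (continuous_sigma hF)

/-- The homotopy is built as a map from the quotient to `C(I, Z)`, so it need not be known that the
product of a quotient map with `I` is a quotient map. -/
theorem homotopic_of_hocolimMk {f g : C(X.Hocolim, Z)}
    (F : ∀ S : {S : Finset ι // S ≠ Finset.univ}, I → X.obj S.1 → FaceSimplex S.1 → Z)
    (hF : ∀ S, Continuous fun p : X.obj S.1 × FaceSimplex S.1 × I => F S p.2.2 p.1 p.2.1)
    (glue : ∀ (S T : {S : Finset ι // S ≠ Finset.univ}) (h : S.1 ⊆ T.1) (s : I) (x : X.obj S.1)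
      (t : FaceSimplex T.1), F S s x (t.incl h) = F T s (X.arrow h x) t)
    (h₀ : ∀ S x t, F S 0 x t = f (X.hocolimMk S x t))
    (h₁ : ∀ S x t, F S 1 x t = g (X.hocolimMk S x t)) : f.Homotopic g := by
  let G : C(X.Hocolim, C(I, Z)) := hocolimLift
    (fun S x t => ⟨fun s => F S s x t, (hF S).comp
      (by fun_prop : Continuous fun s : I => (x, t, s))⟩)
    (fun S => ContinuousMap.continuous_of_continuous_uncurry _ ((hF S).comp
      (by fun_prop : Continuous fun p : (X.obj S.1 × FaceSimplex S.1) × I => (p.1.1, p.1.2, p.2))))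
    (fun S T h x t => ContinuousMap.ext fun s => glue S T h s x t)
  refine ⟨⟨⟨fun p => G p.2 p.1, ?_⟩, ?_, ?_⟩⟩
  · exact (G.continuous.comp continuous_snd).eval continuous_fst
  · exact hocolim_induction h₀
  · exact hocolim_induction h₁

/-- The map of homotopy colimits induced by a map of cubes. -/
def hocolimFunctor {X' : TopCube ι} (φ : X ⟶ X') : C(X.Hocolim, X'.Hocolim) :=
  hocolimLift (fun S x t => X'.hocolimMk S ((φ.app S.1).hom x) t)
    (fun S => (X'.continuous_hocolimMk S).comp
      (((φ.app S.1).hom.continuous.comp continuous_fst).prodMk continuous_snd))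
    (fun S T h x t => by
      rw [hocolimMk_glue h _ (t.incl h) t rfl]
      congr 1
      exact (congrArg (fun f => f.hom x) (φ.naturality (homOfLE h))).symm)

theorem hocolimMap_comp_hocolimFunctor {X' : TopCube ι} (φ : X ⟶ X') :
    X'.hocolimMap.comp (hocolimFunctor φ) = (φ.app Finset.univ).hom.comp X.hocolimMap := by
  refine ContinuousMap.ext (hocolim_induction fun S x t => ?_)
  exact (congrArg (fun f => f.hom x) (φ.naturality (homOfLE (Finset.subset_univ S.1)))).symm

/-- A map of the standard simplex that preserves faces acts on the homotopy colimit, and this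
action is homotopic to the identity. -/
theorem homotopic_id_of_reweight {r : (ι → ℝ) → ι → ℝ}
    (hr : ∀ t ∈ stdSimplex ℝ ι, r t ∈ stdSimplex ℝ ι ∧ ∀ j, t j = 0 → r t j = 0)
    (hc : ContinuousOn r (stdSimplex ℝ ι)) {f : C(X.Hocolim, X.Hocolim)}
    (hf : ∀ S x t, f (X.hocolimMk S x t) = X.hocolimMk S x (t.reweight hr)) :
    f.Homotopic (.id _) := by
  refine homotopic_of_hocolimMk
    (fun S s x t => X.hocolimMk S x (FaceSimplex.segment s (t.reweight hr) t)) (fun S => ?_)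
    (fun S T h s x t => hocolimMk_glue h x _ _ rfl) (fun S x t => ?_) (fun S x t => ?_)
  · refine (X.continuous_hocolimMk S).comp (continuous_fst.prodMk ?_)
    have ht : Continuous fun p : X.obj S.1 × FaceSimplex S.1 × I => p.2.1 := by fun_prop
    exact FaceSimplex.continuous_segment (by fun_prop)
      ((FaceSimplex.continuous_reweight hr hc S.1).comp ht) ht
  · rw [FaceSimplex.segment_zero, hf]
  · rw [FaceSimplex.segment_one]
    rfl

/-- Points of `X_S` and `X_T` with a common preimage in `X_{S ∩ T}` represent the same point of the
homotopy colimit, for the same weight. -/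
theorem hocolimMk_eq_of_inter [DecidableEq ι] {S T : {S : Finset ι // S ≠ Finset.univ}}
    {x : X.obj S.1} {y : X.obj T.1} {t : FaceSimplex S.1} {t' : FaceSimplex T.1} (ht : t.1 = t'.1)
    (w : X.obj (S.1 ∩ T.1)) (hx : X.arrow Finset.inter_subset_left w = x)
    (hy : X.arrow Finset.inter_subset_right w = y) :
    X.hocolimMk S x t = X.hocolimMk T y t' := by
  have hne : S.1 ∩ T.1 ≠ Finset.univ := fun h =>
    S.2 (Finset.univ_subset_iff.1 (h.symm.subset.trans Finset.inter_subset_left))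
  rw [← hx, ← hy]
  have e₁ := hocolimMk_glue (X := X) (S := ⟨S.1 ∩ T.1, hne⟩) (T := S) Finset.inter_subset_left w
    (t.incl Finset.inter_subset_left) t rfl
  have e₂ := hocolimMk_glue (X := X) (S := ⟨S.1 ∩ T.1, hne⟩) (T := T) Finset.inter_subset_right w
    (t.incl Finset.inter_subset_left) t' ht
  exact e₁.symm.trans e₂

end TopCube

/-! ### Coordinates on the homotopy fibers of configuration spaces -/

/-- The cube of homotopy fibers of configuration spaces. -/
abbrev fibCube {n k : ℕ} {i : Fin k} (y : (confCube n k).obj {i}) : TopCube {j : Fin k // j ≠ i} :=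
  (confCube n k).hofiberCube i y

theorem confPoints_injective {n k : ℕ} {i : Fin k} (y : (confCube n k).obj {i}) :
    Function.Injective (confPoints y) := fun _ _ h =>
  Subtype.ext (congrArg (fun c => c.1) (y.2 h))

namespace FibCube

variable {n k : ℕ} {i : Fin k} {y : (confCube n k).obj {i}}

theorem notMem_liftSet_of_notMem {R : Finset {j : Fin k // j ≠ i}} {j : {j : Fin k // j ≠ i}}
    (hj : j ∉ R) : j.1 ∉ liftSet R := by
  simpa [liftSet] using fun _ => hj

theorem notMem_insert_of_notMem {R : Finset {j : Fin k // j ≠ i}} {j : {j : Fin k // j ≠ i}}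
    (hj : j ∉ R) : j.1 ∉ insert i (liftSet R) := by
  rw [Finset.mem_insert]
  exact fun h => h.elim j.2 (notMem_liftSet_of_notMem hj)

theorem notMem_of_notMem_liftSet {R : Finset {j : Fin k // j ≠ i}} {j : Fin k} (hi : j ≠ i)
    (hj : j ∉ liftSet R) : (⟨j, hi⟩ : {j : Fin k // j ≠ i}) ∉ R := fun h =>
  hj (Finset.mem_map_of_mem (Function.Embedding.subtype _) h)

/-- The point labelled by `i`. -/
def pt {R : Finset {j : Fin k // j ≠ i}} (z : (fibCube y).obj R) : EuclideanSpace ℝ (Fin n) :=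
  z.1.1.1 ⟨i, notMem_liftSet R⟩

/-- The path traversed by the point labelled by `j`. -/
def strand {R : Finset {j : Fin k // j ≠ i}} (z : (fibCube y).obj R) (j : {j : Fin k // j ≠ i})
    (hj : j ∉ R) : C(I, EuclideanSpace ℝ (Fin n)) where
  toFun t := (z.1.2 t).1 ⟨j.1, notMem_insert_of_notMem hj⟩
  continuous_toFun := (continuous_apply _).comp (continuous_subtype_val.comp z.1.2.continuous)

/-- The paths traversed by the points with labels other than `i`. If there is no point with a
certain label, then the path is a constant path, which has no meaning. -/
def strands {R : Finset {j : Fin k // j ≠ i}} (z : (fibCube y).obj R) (j : {j : Fin k // j ≠ i}) :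
    C(I, EuclideanSpace ℝ (Fin n)) :=
  if hj : j ∈ R then ContinuousMap.const _ 0 else strand z j hj

theorem strands_of_notMem {R : Finset {j : Fin k // j ≠ i}} (z : (fibCube y).obj R)
    {j : {j : Fin k // j ≠ i}} (hj : j ∉ R) : strands z j = strand z j hj := dif_neg hj

theorem strand_zero {R : Finset {j : Fin k // j ≠ i}} (z : (fibCube y).obj R)
    {j : {j : Fin k // j ≠ i}} (hj : j ∉ R) :
    strand z j hj 0 = z.1.1.1 ⟨j.1, notMem_liftSet_of_notMem hj⟩ :=
  congrArg (fun c => c.1 ⟨j.1, notMem_insert_of_notMem hj⟩) z.2.1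

/-- Conditions on a point and a family of paths, labelled by the complement of `R`, to form a point
of the homotopy fiber. -/
structure Good (y : (confCube n k).obj {i}) (R : Finset {j : Fin k // j ≠ i})
    (x : EuclideanSpace ℝ (Fin n))
    (α : {j : Fin k // j ≠ i} → C(I, EuclideanSpace ℝ (Fin n))) : Prop where
  pt_ne : ∀ j, j ∉ R → x ≠ α j 0
  target : ∀ j, j ∉ R → α j 1 = confPoints y j
  disjoint : ∀ j l, j ∉ R → l ∉ R → j ≠ l → ∀ s, α j s ≠ α l s

theorem Good.mono {R R' : Finset {j : Fin k // j ≠ i}} (h : R ⊆ R')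
    {x : EuclideanSpace ℝ (Fin n)} {α : {j : Fin k // j ≠ i} → C(I, EuclideanSpace ℝ (Fin n))}
    (hg : Good y R x α) : Good y R' x α where
  pt_ne j hj := hg.pt_ne j fun hR => hj (h hR)
  target j hj := hg.target j fun hR => hj (h hR)
  disjoint j l hj hl := hg.disjoint j l (fun hR => hj (h hR)) fun hR => hl (h hR)

theorem good_strands {R : Finset {j : Fin k // j ≠ i}} (z : (fibCube y).obj R) :
    Good y R (pt z) (strands z) where
  pt_ne j hj := by
    rw [strands_of_notMem z hj, strand_zero]
    intro h
    exact j.2 (congrArg (fun c => c.1) (z.1.1.2 h)).symm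
  target j hj := by
    rw [strands_of_notMem z hj]
    exact congrArg (fun c => c.1 ⟨j.1, notMem_insert_of_notMem hj⟩) z.2.2
  disjoint j l hj hl hjl s := by
    rw [strands_of_notMem z hj, strands_of_notMem z hl]
    intro h
    exact hjl (Subtype.ext (congrArg (fun c => c.1) ((z.1.2 s).2 h)))

/-- The point of the homotopy fiber given by a point and a family of paths. -/
def mk (R : Finset {j : Fin k // j ≠ i}) (x : EuclideanSpace ℝ (Fin n))
    (α : {j : Fin k // j ≠ i} → C(I, EuclideanSpace ℝ (Fin n))) (h : Good y R x α) :
    (fibCube y).obj R :=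
  ⟨(⟨fun j => if hj : j.1 = i then x else α ⟨j.1, hj⟩ 0, fun j l hjl => by
      by_cases hj : j.1 = i
      · by_cases hl : l.1 = i
        · exact Subtype.ext (hj.trans hl.symm)
        · simp only [dif_pos hj, dif_neg hl] at hjl
          exact absurd hjl (h.pt_ne _ (notMem_of_notMem_liftSet hl l.2))
      · by_cases hl : l.1 = i
        · simp only [dif_neg hj, dif_pos hl] at hjl
          exact absurd hjl.symm (h.pt_ne _ (notMem_of_notMem_liftSet hj j.2))
        · simp only [dif_neg hj, dif_neg hl] at hjl
          by_contra hne
          exact h.disjoint ⟨j.1, hj⟩ ⟨l.1, hl⟩ (notMem_of_notMem_liftSet hj j.2)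
            (notMem_of_notMem_liftSet hl l.2)
            (fun he => hne (Subtype.ext (congrArg (fun c => c.1) he))) 0 hjl⟩,
    ⟨fun t => ⟨fun j => α ⟨j.1, fun hj => j.2 (Finset.mem_insert.2 (Or.inl hj))⟩ t,
      fun j l hjl => by
        by_contra hne
        exact h.disjoint _ _
          (notMem_of_notMem_liftSet _ fun hj => j.2 (Finset.mem_insert_of_mem hj))
          (notMem_of_notMem_liftSet _ fun hl => l.2 (Finset.mem_insert_of_mem hl))
          (fun he => hne (Subtype.ext (congrArg (fun c => c.1) he))) t hjl⟩,
      Continuous.subtype_mk (continuous_pi fun j => (α _).continuous) _⟩),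
    Subtype.ext (funext fun j =>
      (dif_neg (c := j.1 = i) (t := fun _ => x) (e := fun hj => α ⟨j.1, hj⟩ 0)
        fun hj => j.2 (Finset.mem_insert.2 (Or.inl hj))).symm),
    Subtype.ext (funext fun j =>
      h.target _ (notMem_of_notMem_liftSet _ fun hj => j.2 (Finset.mem_insert_of_mem hj)))⟩

theorem pt_mk {R : Finset {j : Fin k // j ≠ i}} {x : EuclideanSpace ℝ (Fin n)}
    {α : {j : Fin k // j ≠ i} → C(I, EuclideanSpace ℝ (Fin n))} (h : Good y R x α) :
    pt (mk R x α h) = x := dif_pos rfl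

theorem strand_mk {R : Finset {j : Fin k // j ≠ i}} {x : EuclideanSpace ℝ (Fin n)}
    {α : {j : Fin k // j ≠ i} → C(I, EuclideanSpace ℝ (Fin n))} (h : Good y R x α)
    {j : {j : Fin k // j ≠ i}} (hj : j ∉ R) : strand (mk R x α h) j hj = α j := rfl

theorem ext {R : Finset {j : Fin k // j ≠ i}} {z w : (fibCube y).obj R} (h : pt z = pt w)
    (h' : ∀ j (hj : j ∉ R), strand z j hj = strand w j hj) : z = w := by
  refine Subtype.ext (Prod.ext (Subtype.ext (funext fun j => ?_)) (ContinuousMap.ext fun t =>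
    Subtype.ext (funext fun j => ?_)))
  · by_cases hj : j.1 = i
    · obtain ⟨j, hj'⟩ := j
      obtain rfl : j = i := hj
      exact h
    · have hR := notMem_of_notMem_liftSet hj j.2
      exact (strand_zero z hR).symm.trans ((DFunLike.congr_fun (h' _ hR) 0).trans
        (strand_zero w hR))
  · have hj : j.1 ≠ i := fun hj => j.2 (Finset.mem_insert.2 (Or.inl hj))
    have hR := notMem_of_notMem_liftSet hj fun hj => j.2 (Finset.mem_insert_of_mem hj)
    exact DFunLike.congr_fun (h' _ hR) t

theorem mk_pt_strands {R : Finset {j : Fin k // j ≠ i}} (z : (fibCube y).obj R) :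
    mk R (pt z) (strands z) (good_strands z) = z :=
  ext (pt_mk _) fun _ hj => (strand_mk _ hj).trans (strands_of_notMem z hj)

theorem mk_congr {R : Finset {j : Fin k // j ≠ i}} {x x' : EuclideanSpace ℝ (Fin n)}
    {α α' : {j : Fin k // j ≠ i} → C(I, EuclideanSpace ℝ (Fin n))} (h : Good y R x α)
    (h' : Good y R x' α') (hx : x = x') (hα : ∀ j, j ∉ R → α j = α' j) :
    mk R x α h = mk R x' α' h' :=
  ext ((pt_mk h).trans (hx.trans (pt_mk h').symm)) hα

theorem pt_arrow {R R' : Finset {j : Fin k // j ≠ i}} (h : R ⊆ R') (z : (fibCube y).obj R) :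
    pt ((fibCube y).arrow h z) = pt z := rfl

theorem strands_arrow {R R' : Finset {j : Fin k // j ≠ i}} (h : R ⊆ R') (z : (fibCube y).obj R)
    {j : {j : Fin k // j ≠ i}} (hj : j ∉ R') : strands ((fibCube y).arrow h z) j = strands z j := by
  rw [strands_of_notMem _ hj, strands_of_notMem _ fun hR => hj (h hR)]
  rfl

theorem arrow_mk {R R' : Finset {j : Fin k // j ≠ i}} (h : R ⊆ R') {x : EuclideanSpace ℝ (Fin n)}
    {α : {j : Fin k // j ≠ i} → C(I, EuclideanSpace ℝ (Fin n))} (hg : Good y R x α) :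
    (fibCube y).arrow h (mk R x α hg) = mk R' x α (hg.mono h) :=
  ext ((pt_arrow h _).trans ((pt_mk hg).trans (pt_mk _).symm)) fun _ _ => rfl

theorem continuous_pt {R : Finset {j : Fin k // j ≠ i}} :
    Continuous fun z : (fibCube y).obj R => pt z :=
  (continuous_apply _).comp (continuous_subtype_val.comp (continuous_fst.comp
    continuous_subtype_val))

theorem continuous_strands {R : Finset {j : Fin k // j ≠ i}} :
    Continuous fun z : (fibCube y).obj R => strands z := by
  refine continuous_pi fun j => ?_
  by_cases hj : j ∈ R
  · simp only [strands, dif_pos hj]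
    exact continuous_const
  · simp only [strands, dif_neg hj]
    refine ContinuousMap.continuous_of_continuous_uncurry _ ?_
    have h : Continuous fun p : (fibCube y).obj R × I => p.1.1.2 p.2 :=
      (continuous_snd.comp (continuous_subtype_val.comp continuous_fst)).eval continuous_snd
    exact (continuous_apply _).comp (continuous_subtype_val.comp h)

theorem continuous_mk {A : Type} [TopologicalSpace A] {R : Finset {j : Fin k // j ≠ i}}
    {x : A → EuclideanSpace ℝ (Fin n)}
    {α : A → {j : Fin k // j ≠ i} → C(I, EuclideanSpace ℝ (Fin n))} (hx : Continuous x)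
    (hα : Continuous α) (h : ∀ a, Good y R (x a) (α a)) :
    Continuous fun a => mk R (x a) (α a) (h a) := by
  have hα' : ∀ j, Continuous fun p : A × I => α p.1 j p.2 := fun j =>
    ((continuous_apply j).comp (hα.comp continuous_fst)).eval continuous_snd
  refine Continuous.subtype_mk (Continuous.prodMk (Continuous.subtype_mk (continuous_pi fun j => ?_)
    _) (ContinuousMap.continuous_of_continuous_uncurry _
      (Continuous.subtype_mk (continuous_pi fun j => hα' _) _))) _
  by_cases hj : j.1 = i
  · simp only [dif_pos hj]
    exact hx
  · simp only [dif_neg hj]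
    exact (hα' _).comp (by fun_prop : Continuous fun a : A => (a, (0 : I)))

/-! ### The map from the cube of punctured spaces -/

theorem good_const {R : Finset {j : Fin k // j ≠ i}} {x : EuclideanSpace ℝ (Fin n)}
    (hx : x ∈ puncturedSpace (confPoints y) R) :
    Good y R x fun j => ContinuousMap.const I (confPoints y j) where
  pt_ne := hx
  target _ _ := rfl
  disjoint _ _ _ _ hjl _ h := hjl (confPoints_injective y h)

/-- The map that takes a point of a punctured space to the configuration with this additional point
and with the constant path. -/
def ofPunctured (y : (confCube n k).obj {i}) : puncturedCube (confPoints y) ⟶ fibCube y where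
  app R := TopCat.ofHom
    { toFun := fun x => mk R x.1 (fun j => ContinuousMap.const I (confPoints y j)) (good_const x.2)
      continuous_toFun := continuous_mk continuous_subtype_val continuous_const _ }
  naturality R R' h := by
    ext x
    exact (arrow_mk (leOfHom h) (good_const x.2)).symm

theorem ofPunctured_app {R : Finset {j : Fin k // j ≠ i}}
    (x : (puncturedCube (confPoints y)).obj R) :
    ((ofPunctured y).app R).hom x =
      mk R x.1 (fun j => ContinuousMap.const I (confPoints y j)) (good_const x.2) := rfl

/-! ### Contraction of the paths -/

/-- The paths after time `s`, reparametrized. -/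
def trunc {J E : Type} [TopologicalSpace E] (s : I) (α : J → C(I, E)) (j : J) : C(I, E) where
  -- The time `1 - (1 - s) (1 - t)` runs from `s` to `1`.
  toFun t := α j (σ (σ s * σ t))
  continuous_toFun := (α j).continuous.comp (by fun_prop)

theorem trunc_zero {J E : Type} [TopologicalSpace E] (α : J → C(I, E)) : trunc 0 α = α := by
  funext j
  ext t
  simp [trunc]

theorem trunc_one {J E : Type} [TopologicalSpace E] (α : J → C(I, E)) (j : J) :
    trunc 1 α j = ContinuousMap.const I (α j 1) := by
  ext t
  simp [trunc]

theorem trunc_apply_zero {J E : Type} [TopologicalSpace E] (s : I) (α : J → C(I, E)) (j : J) :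
    trunc s α j 0 = α j s := by
  simp [trunc]

theorem trunc_apply_one {J E : Type} [TopologicalSpace E] (s : I) (α : J → C(I, E)) (j : J) :
    trunc s α j 1 = α j 1 := by
  simp [trunc]

theorem continuous_trunc {A J E : Type} [TopologicalSpace A] [TopologicalSpace E] {s : A → I}
    {α : A → J → C(I, E)} (hs : Continuous s) (hα : Continuous α) :
    Continuous fun a => trunc (s a) (α a) := by
  refine continuous_pi fun j => ContinuousMap.continuous_of_continuous_uncurry _ ?_
  exact ((continuous_apply j).comp (hα.comp continuous_fst)).eval (by fun_prop)

/-! ### Dragging the additional point -/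

/-- The extent to which an obstacle of weight `τ j` is present. -/
def presence {J : Type} (τ : J → ℝ) (j : J) : ℝ := min 1 (τ j / 2)

/-- The strength with which an obstacle of weight `τ j` acts. -/
def strength {J : Type} (τ : J → ℝ) (j : J) : ℝ := max 0 (min 1 (τ j - 2))

theorem presence_eq_zero {J : Type} {τ : J → ℝ} {j : J} (h : τ j = 0) : presence τ j = 0 := by
  simp [presence, h]

/-- Presence grows for weights in `[0, 2]` and strength for weights in `[2, 3]`. An obstacle starts
to push only when it is fully taken into account in the radius and the step. -/
theorem presence_of_strength {J : Type} {τ : J → ℝ} {j : J} (h : strength τ j ≠ 0) :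
    presence τ j = 1 := by
  refine min_eq_left ?_
  by_contra! hlt
  exact h (max_eq_left (min_le_of_right_le (by linarith)))

theorem strength_eq_one {J : Type} {τ : J → ℝ} {j : J} (h : 3 ≤ τ j) : strength τ j = 1 := by
  rw [strength, min_eq_left (by linarith), max_eq_right zero_le_one]

/-- The position at time `s` of the point labelled by `i`, when it is dragged along by the points
with weights `τ`. -/
def dragged (τ : {j : Fin k // j ≠ i} → ℝ) {R : Finset {j : Fin k // j ≠ i}} (s : I)
    (z : (fibCube y).obj R) : EuclideanSpace ℝ (Fin n) :=
  Drag.drag (strands z) (presence τ) (strength τ) s (pt z)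

theorem valid_strands {τ : {j : Fin k // j ≠ i} → ℝ} {R : Finset {j : Fin k // j ≠ i}}
    (hτ : ∀ j ∈ R, τ j = 0) (z : (fibCube y).obj R) : Drag.Valid (strands z) (presence τ) :=
  fun j l hj hl => (good_strands z).disjoint j l (fun hR => hj (presence_eq_zero (hτ j hR)))
    fun hR => hl (presence_eq_zero (hτ l hR))

theorem continuous_dragged {A : Type} [TopologicalSpace A] {R : Finset {j : Fin k // j ≠ i}}
    {τ : A → {j : Fin k // j ≠ i} → ℝ} {s : A → I} {z : A → (fibCube y).obj R} (hτ : Continuous τ)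
    (hs : Continuous s) (hz : Continuous z) (hR : ∀ a, ∀ j ∈ R, τ a j = 0) :
    Continuous fun a => dragged (τ a) (s a) (z a) := by
  refine Drag.continuous_drag (continuous_strands.comp hz) ?_ ?_ hs (continuous_pt.comp hz)
    fun a => valid_strands (hR a) (z a)
  · unfold presence
    fun_prop
  · unfold strength
    fun_prop

theorem dragged_zero {τ : {j : Fin k // j ≠ i} → ℝ} {R : Finset {j : Fin k // j ≠ i}}
    (hτ : ∀ j ∈ R, τ j = 0) (z : (fibCube y).obj R) : dragged τ 0 z = pt z :=
  Drag.drag_zero (valid_strands hτ z) _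

/-- The forgotten labels have weight zero, hence presence zero, so `Drag.drag` does not see that
their strands are replaced by a default path. -/
theorem dragged_arrow {τ : {j : Fin k // j ≠ i} → ℝ} {R R' : Finset {j : Fin k // j ≠ i}}
    (h : R ⊆ R') (hτ : ∀ j ∈ R', τ j = 0) (s : I) (z : (fibCube y).obj R) :
    dragged τ s ((fibCube y).arrow h z) = dragged τ s z :=
  Drag.drag_congr (fun _ hj => strands_arrow h z fun hR => hj (presence_eq_zero (hτ _ hR)))
    (fun _ => presence_of_strength) s _

theorem dragged_ofPunctured {τ : {j : Fin k // j ≠ i} → ℝ} {R : Finset {j : Fin k // j ≠ i}}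
    (hτ : ∀ j ∈ R, τ j = 0) (s : I) (x : (puncturedCube (confPoints y)).obj R) :
    dragged τ s (((ofPunctured y).app R).hom x) = x.1 := by
  rw [ofPunctured_app, dragged, pt_mk]
  refine (Drag.drag_congr (fun j hj => ?_) (fun _ => presence_of_strength) s _).trans
    (Drag.drag_of_const (a := fun j => ContinuousMap.const I (confPoints y j)) (fun _ _ => rfl) s _)
  rw [strands_of_notMem _ fun hR => hj (presence_eq_zero (hτ _ hR))]
  rfl

/-- Labels outside `R'` have weight at least `3`, so they act with full strength and the dragged
point avoids them. They are not in `R`, where the weight is zero, so their strands are genuine. -/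
theorem good_dragged {τ : {j : Fin k // j ≠ i} → ℝ} {R R' : Finset {j : Fin k // j ≠ i}}
    (hτ : ∀ j ∈ R, τ j = 0) (hR' : ∀ j, j ∉ R' → 3 ≤ τ j) (s : I) (z : (fibCube y).obj R) :
    Good y R' (dragged τ s z) (trunc s (strands z)) := by
  have hR : ∀ j, j ∉ R' → j ∉ R := fun j hj hjR => by
    have := hR' j hj
    rw [hτ j hjR] at this
    norm_num at this
  have hg := good_strands z
  refine ⟨fun j hj => ?_, fun j hj => ?_, fun j l hj hl hjl t => ?_⟩
  · rw [trunc_apply_zero]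
    refine Drag.drag_ne (valid_strands hτ z) (fun _ => presence_of_strength)
      (fun _ => le_max_left _ _)
      (fun _ => max_le zero_le_one (min_le_left _ _)) (strength_eq_one (hR' j hj))
      (hg.pt_ne j (hR j hj)) s
  · rw [trunc_apply_one]
    exact hg.target j (hR j hj)
  · exact hg.disjoint j l (hR j hj) (hR l hl) hjl _

theorem dragged_one_mem {τ : {j : Fin k // j ≠ i} → ℝ} {R R' : Finset {j : Fin k // j ≠ i}}
    (hτ : ∀ j ∈ R, τ j = 0) (hR' : ∀ j, j ∉ R' → 3 ≤ τ j) (z : (fibCube y).obj R) :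
    dragged τ 1 z ∈ puncturedSpace (confPoints y) R' := by
  intro j hj
  have h := good_dragged hτ hR' 1 z
  have h₁ := h.pt_ne j hj
  rwa [← h.target j hj, trunc_apply_one, ← trunc_apply_zero]

theorem mk_dragged_one {τ : {j : Fin k // j ≠ i} → ℝ} {R R' : Finset {j : Fin k // j ≠ i}}
    (hτ : ∀ j ∈ R, τ j = 0) (hR' : ∀ j, j ∉ R' → 3 ≤ τ j) (z : (fibCube y).obj R) :
    mk R' (dragged τ 1 z) (trunc 1 (strands z)) (good_dragged hτ hR' 1 z) =
      ((ofPunctured y).app R').hom ⟨dragged τ 1 z, dragged_one_mem hτ hR' z⟩ := by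
  refine (mk_congr _ (good_const (dragged_one_mem hτ hR' z)) rfl fun j hj => ?_).trans
    (ofPunctured_app (R := R') ⟨dragged τ 1 z, dragged_one_mem hτ hR' z⟩).symm
  rw [trunc_one, ← (good_dragged hτ hR' 1 z).target j hj, trunc_apply_one]

theorem mk_dragged_zero {τ : {j : Fin k // j ≠ i} → ℝ} {R R' : Finset {j : Fin k // j ≠ i}}
    (hτ : ∀ j ∈ R, τ j = 0) (hR' : ∀ j, j ∉ R' → 3 ≤ τ j) (h : R ⊆ R') (z : (fibCube y).obj R) :
    mk R' (dragged τ 0 z) (trunc 0 (strands z)) (good_dragged hτ hR' 0 z) =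
      (fibCube y).arrow h z := by
  conv_rhs => rw [← mk_pt_strands z, arrow_mk]
  exact mk_congr _ _ (dragged_zero hτ z) fun j _ => by rw [trunc_zero]

/-- The inverse drags the point up to time `1` with all obstacles at full strength. It is a strict
left inverse, since resting obstacles do not push; in the other order, dragging up to time `s` while
cutting off the paths before `s` is a homotopy to the identity. -/
theorem isHtpyEquiv_ofPunctured (y : (confCube n k).obj {i}) (R : Finset {j : Fin k // j ≠ i}) :
    IsHtpyEquiv ((ofPunctured y).app R).hom := by
  let τ : {j : Fin k // j ≠ i} → ℝ := fun j => if j ∈ R then 0 else 3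
  have hτ : ∀ j ∈ R, τ j = 0 := fun j hj => if_pos hj
  have hR : ∀ j, j ∉ R → 3 ≤ τ j := fun j hj => (if_neg hj).ge
  let g : C((fibCube y).obj R, (puncturedCube (confPoints y)).obj R) :=
    ⟨fun z => ⟨dragged τ 1 z, dragged_one_mem hτ hR z⟩, Continuous.subtype_mk (continuous_dragged
      continuous_const continuous_const continuous_id fun _ => hτ) _⟩
  have hg : g.comp ((ofPunctured y).app R).hom = .id _ := ContinuousMap.ext fun x =>
    Subtype.ext (dragged_ofPunctured hτ 1 x)
  refine ⟨g, hg ▸ ContinuousMap.Homotopic.refl _, ⟨?_⟩⟩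
  · refine ContinuousMap.Homotopy.symm ⟨⟨fun p => mk R (dragged τ p.1 p.2)
      (trunc p.1 (strands p.2)) (good_dragged hτ hR p.1 p.2), ?_⟩, fun z => ?_, fun z => ?_⟩
    · exact continuous_mk (continuous_dragged continuous_const continuous_fst continuous_snd
        fun _ => hτ) (continuous_trunc continuous_fst (continuous_strands.comp continuous_snd)) _
    · exact (mk_dragged_zero hτ hR subset_rfl z).trans (TopCube.arrow_self _ _ _)
    · exact mk_dragged_one hτ hR z

end FibCube

/-! ### Maps into homotopy colimits of punctured cubes -/

theorem FaceSimplex.ne_univ {ι : Type} [Fintype ι] {S : Finset ι} (t : FaceSimplex S) :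
    S ≠ Finset.univ := by
  rintro rfl
  have h := t.2.1.2
  rw [Finset.sum_eq_zero fun j hj => t.2.2 j hj] at h
  exact zero_ne_one h

namespace TopCube

/-- Data that describe a map from `A` to the homotopy colimit: a weight for every point of `A`,
and compatible representatives of its image in the spaces `X_U`, for some sets `U` which may be
chosen locally constant. -/
structure HocolimData {ι : Type} [Fintype ι] [DecidableEq ι] (X : TopCube ι) (A : Type)
    [TopologicalSpace A] where
  /-- The sets `U` for which there is a representative in `X_U`. -/
  P : A → Finset ι → Prop
  /-- The weight. -/
  w : A → ι → ℝ
  /-- The representatives. -/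
  x : ∀ a U, P a U → X.obj U
  w_mem : ∀ a U, P a U → w a ∈ stdSimplex ℝ ι ∧ ∀ j ∈ U, w a j = 0
  inter : ∀ a U U', P a U → P a U' → P a (U ∩ U')
  arrow : ∀ a U U' (h : U ⊆ U') (hU : P a U) (hU' : P a U'), X.arrow h (x a U hU) = x a U' hU'
  eventually : ∀ a, ∃ U, ∀ᶠ a' in nhds a, P a' U
  continuous_w : Continuous w
  continuous_x : ∀ U, Continuous fun a : {a // P a U} => x a.1 U a.2

namespace HocolimData

variable {ι : Type} [Fintype ι] [DecidableEq ι] {X : TopCube ι} {A : Type} [TopologicalSpace A]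
  (D : X.HocolimData A)

/-- The weight, as a point of a face of the simplex. -/
def weight {a : A} {U : Finset ι} (h : D.P a U) : FaceSimplex U := ⟨D.w a, D.w_mem a U h⟩

/-- The point represented by the representative in `X_U`. -/
def point {a : A} {U : Finset ι} (h : D.P a U) : X.Hocolim :=
  X.hocolimMk ⟨U, (D.weight h).ne_univ⟩ (D.x a U h) (D.weight h)

theorem point_eq {a : A} {U U' : Finset ι} (h : D.P a U) (h' : D.P a U') :
    D.point h = D.point h' :=
  hocolimMk_eq_of_inter (S := ⟨U, (D.weight h).ne_univ⟩) (T := ⟨U', (D.weight h').ne_univ⟩) rfl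
    (D.x a (U ∩ U') (D.inter a U U' h h')) (D.arrow _ _ _ _ _ _) (D.arrow _ _ _ _ _ _)

theorem exists_P (a : A) : ∃ U, D.P a U := (D.eventually a).imp fun _ h => h.self_of_nhds

/-- The map described by the data. -/
def toMap : C(A, X.Hocolim) where
  toFun a := D.point (D.exists_P a).choose_spec
  continuous_toFun := by
    rw [continuous_iff_continuousAt]
    intro a
    obtain ⟨U, hU⟩ := D.eventually a
    obtain ⟨V, hV, hVo, ha⟩ := eventually_nhds_iff.1 hU
    refine ContinuousOn.continuousAt (s := V) ?_ (hVo.mem_nhds ha)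
    rw [continuousOn_iff_continuous_domRestrict]
    -- Near `a` the chosen sets can be replaced by the single set `U`, because `point` does not
    -- depend on the representative.
    have hc : Continuous fun b : V => D.point (hV b.1 b.2) := by
      refine (X.continuous_hocolimMk ⟨U, (D.weight (hV a ha)).ne_univ⟩).comp
        (Continuous.prodMk (f := fun b : V => D.x b.1 U (hV b.1 b.2)) ?_
          (Continuous.subtype_mk (D.continuous_w.comp continuous_subtype_val) _))
      exact (D.continuous_x U).comp
        (Continuous.subtype_mk continuous_subtype_val fun b => hV b.1 b.2)
    refine hc.congr fun b => ?_
    exact D.point_eq _ _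

theorem toMap_eq {a : A} {U : Finset ι} (h : D.P a U) : D.toMap a = D.point h :=
  D.point_eq (D.exists_P a).choose_spec h

end HocolimData

end TopCube

/-! ### A map of the standard simplex that makes small weights zero -/

section Sharpen

variable {ι : Type} [Fintype ι]

/-- The weight `t j`, normalized such that the maximum is at least `8`. -/
def level (t : ι → ℝ) (j : ι) : ℝ := 8 * Fintype.card ι * t j

/-- The levels have average `8`. -/
theorem exists_le_level {t : ι → ℝ} (ht : t ∈ stdSimplex ℝ ι) : ∃ j, 8 ≤ level t j := by
  by_contra! h
  have hne : (Finset.univ : Finset ι).Nonempty := by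
    rw [Finset.nonempty_iff_ne_empty]
    intro he
    have := ht.2
    rw [he, Finset.sum_empty] at this
    exact zero_ne_one this
  have h₁ := Finset.sum_lt_sum_of_nonempty hne fun j _ => h j
  simp only [level] at h₁
  rw [← Finset.mul_sum, ht.2, Finset.sum_const, Finset.card_univ, nsmul_eq_mul] at h₁
  linarith

/-- Normalization of a family of nonnegative numbers. -/
def normalizeSum (μ : ι → ℝ) (j : ι) : ℝ := μ j / ∑ l, μ l

theorem normalizeSum_mem {μ : ι → ℝ} (h : ∀ j, 0 ≤ μ j) (h' : 0 < ∑ l, μ l) :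
    normalizeSum μ ∈ stdSimplex ℝ ι := by
  refine ⟨fun j => div_nonneg (h j) h'.le, ?_⟩
  simp only [normalizeSum]
  rw [← Finset.sum_div, div_self h'.ne']

/-- The map of the standard simplex that makes small weights zero. -/
def sharpen (t : ι → ℝ) : ι → ℝ := normalizeSum fun j => max 0 (level t j - 4)

theorem sum_pos_of_mem {t : ι → ℝ} (ht : t ∈ stdSimplex ℝ ι) :
    0 < ∑ j, max 0 (level t j - 4) := by
  obtain ⟨j, hj⟩ := exists_le_level ht
  refine Finset.sum_pos' (fun _ _ => le_max_left _ _) ⟨j, Finset.mem_univ j, ?_⟩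
  exact lt_max_of_lt_right (by linarith)

theorem sharpen_eq_zero {t : ι → ℝ} {j : ι} (h : level t j ≤ 4) : sharpen t j = 0 := by
  rw [sharpen, normalizeSum, max_eq_left (by linarith), zero_div]

theorem sharpen_mem (t : ι → ℝ) (ht : t ∈ stdSimplex ℝ ι) :
    sharpen t ∈ stdSimplex ℝ ι ∧ ∀ j, t j = 0 → sharpen t j = 0 :=
  ⟨normalizeSum_mem (fun _ => le_max_left _ _) (sum_pos_of_mem ht), fun j hj =>
    sharpen_eq_zero (by simp [level, hj])⟩

theorem continuous_level : Continuous (level (ι := ι)) :=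
  continuous_pi fun j => continuous_const.mul (continuous_apply j)

theorem continuousOn_sharpen : ContinuousOn (sharpen (ι := ι)) (stdSimplex ℝ ι) := by
  have h : ∀ j, Continuous fun t : ι → ℝ => max 0 (level t j - 4) := fun j =>
    continuous_const.max (((continuous_apply j).comp continuous_level).sub continuous_const)
  refine continuousOn_pi.2 fun j => (h j).continuousOn.div
    (continuous_finsetSum _ fun l _ => h l).continuousOn fun t ht => (sum_pos_of_mem ht).ne'

end Sharpen

namespace FibCube

variable {n k : ℕ} {i : Fin k} {y : (confCube n k).obj {i}} {T S : Finset {j : Fin k // j ≠ i}}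

/-- The set of labels that corresponds to a set of directions of a face. -/
abbrev faceSet (T S : Finset {j : Fin k // j ≠ i}) (U : Finset {j // j ∈ S \ T}) :
    Finset {j : Fin k // j ≠ i} := T ∪ U.map (Function.Embedding.subtype _)

theorem faceSet_mono {U U' : Finset {j // j ∈ S \ T}} (h : U ⊆ U') :
    faceSet T S U ⊆ faceSet T S U' :=
  Finset.union_subset_union_right (Finset.map_subset_map.2 h)

theorem mem_faceSet {U : Finset {j // j ∈ S \ T}} {j : {j : Fin k // j ≠ i}} :
    j ∈ faceSet T S U ↔ j ∈ T ∨ ∃ h : j ∈ S \ T, ⟨j, h⟩ ∈ U := by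
  simp [faceSet]

theorem notMem_faceSet_inter {U U' : Finset {j // j ∈ S \ T}} {j : {j : Fin k // j ≠ i}}
    (h : j ∉ faceSet T S (U ∩ U')) : j ∉ faceSet T S U ∨ j ∉ faceSet T S U' := by
  by_contra! hc
  refine h (mem_faceSet.2 ?_)
  rcases mem_faceSet.1 hc.1 with hT | ⟨hj, hU⟩
  · exact Or.inl hT
  · rcases mem_faceSet.1 hc.2 with hT | ⟨_, hU'⟩
    · exact Or.inl hT
    · exact Or.inr ⟨hj, Finset.mem_inter.2 ⟨hU, hU'⟩⟩

/-! ### The homotopy colimits of the faces of the two cubes -/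

/-- The weights of the labels determined by a weight of the directions of a face. -/
def faceWeight (T S : Finset {j : Fin k // j ≠ i}) (t : {j // j ∈ S \ T} → ℝ)
    (j : {j : Fin k // j ≠ i}) : ℝ :=
  -- Labels in `T` are absent from the whole face. Labels outside `S` and `T` are present in all its
  -- spaces and must always be avoided, so they get weight `3`, which suffices for full strength.
  if h : j ∈ S \ T then level t ⟨j, h⟩ else if j ∈ T then 0 else 3

theorem continuous_faceWeight : Continuous (faceWeight T S) := by
  refine continuous_pi fun j => ?_
  unfold faceWeight
  split_ifs
  · exact (continuous_apply _).comp continuous_level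
  · exact continuous_const
  · exact continuous_const

theorem faceWeight_eq_zero {U : Finset {j // j ∈ S \ T}} (t : FaceSimplex U) :
    ∀ j ∈ faceSet T S U, faceWeight T S t.1 j = 0 := by
  intro j hj
  rcases mem_faceSet.1 hj with hT | ⟨h, hU⟩
  · have h : j ∉ S \ T := fun h => (Finset.mem_sdiff.1 h).2 hT
    rw [faceWeight, dif_neg h, if_pos hT]
  · rw [faceWeight, dif_pos h, level, t.2.2 _ hU, mul_zero]

/-- The weight is small in the directions in `U` and large in the other directions. -/
def IsSplit {ι : Type} [Fintype ι] (t : ι → ℝ) (U : Finset ι) : Prop :=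
  (∀ j, j ∉ U → 3 ≤ level t j) ∧ ∀ j ∈ U, level t j ≤ 4

theorem IsSplit.inter {ι : Type} [Fintype ι] [DecidableEq ι] {t : ι → ℝ} {U U' : Finset ι}
    (h : IsSplit t U) (h' : IsSplit t U') : IsSplit t (U ∩ U') := by
  refine ⟨fun j hj => ?_, fun j hj => h.2 j (Finset.mem_inter.1 hj).1⟩
  by_cases hU : j ∈ U
  · exact h'.1 j fun hU' => hj (Finset.mem_inter.2 ⟨hU, hU'⟩)
  · exact h.1 j hU

/-- The levels between `3` and `4` may go to either side. This overlap is what allows `U` to be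
locally constant: a level below `4` stays below `4`, and one that is at least `4` stays above `3`.
-/
theorem exists_eventually_isSplit {ι A : Type} [Fintype ι] [TopologicalSpace A] {t : A → ι → ℝ}
    (ht : Continuous t) (a : A) : ∃ U, ∀ᶠ a' in nhds a, IsSplit (t a') U := by
  classical
  have hc : ∀ j, Continuous fun a => level (t a) j := fun j =>
    (continuous_apply j).comp (continuous_level.comp ht)
  refine ⟨Finset.univ.filter fun j => level (t a) j < 4, ?_⟩
  have h : ∀ j, ∀ᶠ a' in nhds a, (¬ level (t a) j < 4 → 3 ≤ level (t a') j) ∧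
      (level (t a) j < 4 → level (t a') j ≤ 4) := by
    intro j
    by_cases hj : level (t a) j < 4
    · filter_upwards [(hc j).continuousAt.eventually (gt_mem_nhds hj)] with a' ha'
      exact ⟨fun h => absurd hj h, fun _ => ha'.le⟩
    · have hj' : 3 < level (t a) j := by linarith
      filter_upwards [(hc j).continuousAt.eventually (lt_mem_nhds hj')] with a' ha'
      exact ⟨fun _ => ha'.le, fun h => absurd h hj⟩
  filter_upwards [Filter.eventually_all.2 h] with a' ha'
  exact ⟨fun j hj => (ha' j).1 (by simpa using hj), fun j hj => (ha' j).2 (by simpa using hj)⟩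

theorem IsSplit.faceWeight {t : {j // j ∈ S \ T} → ℝ} {U : Finset {j // j ∈ S \ T}}
    (h : IsSplit t U) : ∀ j, j ∉ faceSet T S U → 3 ≤ faceWeight T S t j := by
  intro j hj
  rw [mem_faceSet, not_or] at hj
  rw [FibCube.faceWeight]
  split_ifs with hS hT
  · exact h.1 _ fun hU => hj.2 ⟨hS, hU⟩
  · exact absurd hT hj.1
  · exact le_rfl

theorem IsSplit.sharpen {ι : Type} [Fintype ι] {t : ι → ℝ} {U : Finset ι} (h : IsSplit t U)
    (ht : t ∈ stdSimplex ℝ ι) : sharpen t ∈ stdSimplex ℝ ι ∧ ∀ j ∈ U, sharpen t j = 0 :=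
  ⟨(sharpen_mem t ht).1, fun j hj => sharpen_eq_zero (h.2 j hj)⟩

theorem IsSplit.subset {ι : Type} [Fintype ι] {U₀ U : Finset ι} {t : FaceSimplex U₀}
    (h : IsSplit t.1 U) : U₀ ⊆ U := by
  intro j hj
  by_contra hU
  have := h.1 j hU
  rw [level, t.2.2 j hj, mul_zero] at this
  norm_num at this

theorem subset_of_isSplit {U₀ U : Finset {j // j ∈ S \ T}} {t : FaceSimplex U₀}
    (h : IsSplit t.1 U) {j : {j : Fin k // j ≠ i}} (hj : j ∉ faceSet T S U) :
    j ∉ faceSet T S U₀ := fun h₀ => hj (faceSet_mono h.subset h₀)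

/-- The homotopy that drags the point labelled by `i` along the other points, on the homotopy
colimit of a face of the cube of homotopy fibers. -/
def dragData (y : (confCube n k).obj {i}) (T S : Finset {j : Fin k // j ≠ i})
    (U₀ : Finset {j // j ∈ S \ T}) :
    ((fibCube y).face T S).HocolimData
      ((fibCube y).obj (faceSet T S U₀) × FaceSimplex U₀ × I) where
  P a U := IsSplit a.2.1.1 U
  w a := sharpen a.2.1.1
  x a U h := mk (faceSet T S U) (dragged (faceWeight T S a.2.1.1) a.2.2 a.1)
    (trunc a.2.2 (strands a.1)) (good_dragged (faceWeight_eq_zero a.2.1) h.faceWeight a.2.2 a.1)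
  w_mem a _ h := h.sharpen a.2.1.2.1
  inter _ _ _ h h' := h.inter h'
  arrow _ _ _ h _ _ := arrow_mk (faceSet_mono h) _
  eventually a := exists_eventually_isSplit
    (FaceSimplex.continuous_val.comp (continuous_fst.comp continuous_snd)) a
  continuous_w := continuousOn_sharpen.comp_continuous
    (FaceSimplex.continuous_val.comp (continuous_fst.comp continuous_snd)) fun a => a.2.1.2.1
  continuous_x U := by
    have hτ : Continuous fun a : {a : (fibCube y).obj (faceSet T S U₀) × FaceSimplex U₀ × I //
        IsSplit a.2.1.1 U} => faceWeight T S a.1.2.1.1 :=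
      continuous_faceWeight.comp (FaceSimplex.continuous_val.comp
        (continuous_fst.comp (continuous_snd.comp continuous_subtype_val)))
    refine continuous_mk (continuous_dragged hτ ?_ ?_ fun a => faceWeight_eq_zero a.1.2.1)
      (continuous_trunc ?_ (continuous_strands.comp ?_)) _
    · exact continuous_snd.comp (continuous_snd.comp continuous_subtype_val)
    · exact continuous_fst.comp continuous_subtype_val
    · exact continuous_snd.comp (continuous_snd.comp continuous_subtype_val)
    · exact continuous_fst.comp continuous_subtype_val

/-- The map that drags the point labelled by `i` along the other points, on the homotopy
colimit of a face of the cube of homotopy fibers. -/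
def endData (y : (confCube n k).obj {i}) (T S : Finset {j : Fin k // j ≠ i})
    (U₀ : Finset {j // j ∈ S \ T}) :
    ((puncturedCube (confPoints y)).face T S).HocolimData
      ((fibCube y).obj (faceSet T S U₀) × FaceSimplex U₀) where
  P a U := IsSplit a.2.1 U
  w a := sharpen a.2.1
  x a U h := ⟨dragged (faceWeight T S a.2.1) 1 a.1,
    dragged_one_mem (R' := faceSet T S U) (faceWeight_eq_zero a.2) h.faceWeight a.1⟩
  w_mem a _ h := h.sharpen a.2.2.1
  inter _ _ _ h h' := h.inter h'
  arrow _ _ _ _ _ _ := rfl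
  eventually a := exists_eventually_isSplit (FaceSimplex.continuous_val.comp continuous_snd) a
  continuous_w := continuousOn_sharpen.comp_continuous
    (FaceSimplex.continuous_val.comp continuous_snd) fun a => a.2.2.1
  continuous_x U := by
    have hτ : Continuous fun a : {a : (fibCube y).obj (faceSet T S U₀) × FaceSimplex U₀ //
        IsSplit a.2.1 U} => faceWeight T S a.1.2.1 :=
      continuous_faceWeight.comp (FaceSimplex.continuous_val.comp
        (continuous_snd.comp continuous_subtype_val))
    exact Continuous.subtype_mk (continuous_dragged hτ continuous_const
      (continuous_fst.comp continuous_subtype_val) fun a => faceWeight_eq_zero a.1.2) _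

/-- The map from a face of the cube of punctured spaces to a face of the cube of homotopy fibers. -/
abbrev ofPuncturedFace (y : (confCube n k).obj {i}) (T S : Finset {j : Fin k // j ≠ i}) :
    (puncturedCube (confPoints y)).face T S ⟶ (fibCube y).face T S :=
  Functor.whiskerLeft _ (ofPunctured y)

/-- A homotopy inverse of the map between homotopy colimits of faces. -/
def endMap (y : (confCube n k).obj {i}) (T S : Finset {j : Fin k // j ≠ i}) :
    C(((fibCube y).face T S).Hocolim, ((puncturedCube (confPoints y)).face T S).Hocolim) :=
  TopCube.hocolimLift (X := (fibCube y).face T S) (fun U z t => (endData y T S U.1).toMap (z, t))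
    (fun U => (endData y T S U.1).toMap.continuous) (fun U U' h z t => by
      obtain ⟨V, hV⟩ := (endData y T S U'.1).exists_P ((fibCube y).arrow (faceSet_mono h) z, t)
      -- The admissible sets depend only on the weight, which is the same on both sides of the
      -- gluing.
      have hV' : (endData y T S U.1).P (z, t.incl h) V := hV
      refine ((endData y T S U.1).toMap_eq hV').trans
        (Eq.trans ?_ ((endData y T S U'.1).toMap_eq hV).symm)
      refine TopCube.hocolimMk_congr (Subtype.ext ?_) rfl
      exact (dragged_arrow (faceSet_mono h) (faceWeight_eq_zero t) 1 z).symm)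

/-- The self-map of a homotopy colimit given by the action of `sharpen`. -/
def sharpenMap {ι : Type} [Fintype ι] (X : TopCube ι) : C(X.Hocolim, X.Hocolim) :=
  TopCube.hocolimLift (fun U x t => X.hocolimMk U x (t.reweight sharpen_mem))
    (fun U => (X.continuous_hocolimMk U).comp (continuous_fst.prodMk
      ((FaceSimplex.continuous_reweight sharpen_mem continuousOn_sharpen U.1).comp continuous_snd)))
    (fun _ _ h x _ => TopCube.hocolimMk_glue h x _ _ rfl)

theorem sharpenMap_homotopic {ι : Type} [Fintype ι] (X : TopCube ι) :
    (sharpenMap X).Homotopic (.id _) :=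
  TopCube.homotopic_id_of_reweight sharpen_mem continuousOn_sharpen fun _ _ _ => rfl

/-- Constant paths do not drag the point, so only the action of `sharpen` on the weights remains. -/
theorem endMap_comp (y : (confCube n k).obj {i}) (T S : Finset {j : Fin k // j ≠ i}) :
    (endMap y T S).comp (TopCube.hocolimFunctor (ofPuncturedFace y T S)) = sharpenMap _ := by
  refine ContinuousMap.ext (TopCube.hocolim_induction fun U x t => ?_)
  let z : (fibCube y).obj (faceSet T S U.1) := ((ofPunctured y).app (faceSet T S U.1)).hom x
  obtain ⟨V, hV⟩ := (endData y T S U.1).exists_P (z, t)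
  have hs : IsSplit t.1 V := hV
  refine ((endData y T S U.1).toMap_eq hV).trans (Eq.trans ?_
    (TopCube.hocolimMk_glue (T := ⟨V, ((endData y T S U.1).weight hV).ne_univ⟩) hs.subset x
      (t.reweight sharpen_mem)
      ((endData y T S U.1).weight hV) rfl).symm)
  refine TopCube.hocolimMk_congr (Subtype.ext ?_) rfl
  exact dragged_ofPunctured (faceWeight_eq_zero t) 1 x

/-- Dragging up to time `s` is the homotopy. At `s = 0` only the weights have changed; at `s = 1`
the remaining paths are constant, so the configuration comes from the punctured space. -/
theorem comp_endMap_homotopic (y : (confCube n k).obj {i}) (T S : Finset {j : Fin k // j ≠ i}) :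
    (sharpenMap ((fibCube y).face T S)).Homotopic
      ((TopCube.hocolimFunctor (ofPuncturedFace y T S)).comp (endMap y T S)) := by
  refine TopCube.homotopic_of_hocolimMk
    (fun U s z t => (dragData y T S U.1).toMap (z, t, s))
    (fun U => (dragData y T S U.1).toMap.continuous) (fun U U' h s z t => ?_) (fun U z t => ?_)
    (fun U z t => ?_)
  · obtain ⟨V, hV⟩ := (dragData y T S U'.1).exists_P ((fibCube y).arrow (faceSet_mono h) z, t, s)
    have hV' : (dragData y T S U.1).P (z, t.incl h, s) V := hV
    refine ((dragData y T S U.1).toMap_eq hV').trans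
      (Eq.trans ?_ ((dragData y T S U'.1).toMap_eq hV).symm)
    refine TopCube.hocolimMk_congr (mk_congr
      (good_dragged (faceWeight_eq_zero (t.incl h)) (IsSplit.faceWeight hV') s z)
      (good_dragged (faceWeight_eq_zero t) (IsSplit.faceWeight hV) s _) ?_ fun j hj => ?_) rfl
    · exact (dragged_arrow (faceSet_mono h) (faceWeight_eq_zero t) s z).symm
    · ext1 r
      exact DFunLike.congr_fun (strands_arrow (faceSet_mono h) z
        (subset_of_isSplit (t := t) hV hj)).symm _
  · obtain ⟨V, hV⟩ := (dragData y T S U.1).exists_P (z, t, 0)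
    have hs : IsSplit t.1 V := hV
    refine ((dragData y T S U.1).toMap_eq hV).trans (Eq.trans ?_
      (TopCube.hocolimMk_glue (T := ⟨V, ((dragData y T S U.1).weight hV).ne_univ⟩) hs.subset z
        (t.reweight sharpen_mem)
        ((dragData y T S U.1).weight hV) rfl).symm)
    refine TopCube.hocolimMk_congr ?_ rfl
    exact mk_dragged_zero (faceWeight_eq_zero t) (IsSplit.faceWeight hV)
      (faceSet_mono hs.subset) z
  · obtain ⟨V, hV⟩ := (dragData y T S U.1).exists_P (z, t, 1)
    have hV' : (endData y T S U.1).P (z, t) V := hV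
    refine ((dragData y T S U.1).toMap_eq hV).trans (Eq.trans ?_ (congrArg
      (TopCube.hocolimFunctor (ofPuncturedFace y T S)) ((endData y T S U.1).toMap_eq hV').symm))
    refine TopCube.hocolimMk_congr ?_ rfl
    exact mk_dragged_one (faceWeight_eq_zero t) (IsSplit.faceWeight hV) z

theorem isHtpyEquiv_hocolimFunctor (y : (confCube n k).obj {i})
    (T S : Finset {j : Fin k // j ≠ i}) :
    IsHtpyEquiv (TopCube.hocolimFunctor (ofPuncturedFace y T S)) :=
  ⟨endMap y T S, endMap_comp y T S ▸ sharpenMap_homotopic _,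
    (comp_endMap_homotopic y T S).symm.trans (sharpenMap_homotopic _)⟩

end FibCube

/-! ### The homotopy colimits of the faces of the cube of punctured spaces -/

namespace PuncturedCube

variable {n k : ℕ} {i : Fin k} {y : (confCube n k).obj {i}} {T S : Finset {j : Fin k // j ≠ i}}

/-- The radius for resting obstacles is a lower bound for half the distances; halving it makes the
inequality strict. -/
theorem exists_separation {E ι : Type} [NormedAddCommGroup E] [Finite ι] {p : ι → E}
    (hp : Function.Injective p) : ∃ ε > 0, ∀ j l, j ≠ l → 2 * ε < ‖p j - p l‖ := by
  classical
  have := Fintype.ofFinite ι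
  let a : ι → C(I, E) := fun j => ContinuousMap.const I (p j)
  have ha : Drag.Valid a fun _ => 1 := fun j l _ _ hjl _ h => hjl (hp h)
  refine ⟨Drag.radius a (fun _ => 1) / 2, half_pos ha.radius_pos, fun j l hjl => ?_⟩
  have h : 2 * Drag.radius a (fun _ => 1) ≤ ‖p j - p l‖ := Drag.two_radius_le a rfl rfl hjl 0
  have := ha.radius_pos
  linarith

/-- Weights that vanish near the points `p j`. -/
def coverWeight {E ι : Type} [NormedAddCommGroup E] [Fintype ι] (p : ι → E) (ε : ℝ) (x : E) :
    ι → ℝ := normalizeSum fun j => max 0 (‖x - p j‖ - ε)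

theorem coverWeight_eq_zero {E ι : Type} [NormedAddCommGroup E] [Fintype ι] {p : ι → E} {ε : ℝ}
    {x : E} {j : ι} (h : ‖x - p j‖ ≤ ε) : coverWeight p ε x j = 0 := by
  rw [coverWeight, normalizeSum, max_eq_left (sub_nonpos.2 h), zero_div]

section

variable {E ι : Type} [NormedAddCommGroup E] [Fintype ι] [Nontrivial ι] {p : ι → E} {ε : ℝ}
  (hp : ∀ j l, j ≠ l → 2 * ε < ‖p j - p l‖)

include hp

/-- No `x` is within `ε` of two of the points. As there are at least two points, some summand is
positive; this is where the dimension of the face enters. -/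
theorem coverWeight_sum_pos (x : E) : 0 < ∑ j, max 0 (‖x - p j‖ - ε) := by
  obtain ⟨j, l, hjl⟩ := exists_pair_ne ι
  have h := hp j l hjl
  have h₁ : ‖p j - p l‖ ≤ ‖x - p j‖ + ‖x - p l‖ := by
    rw [norm_sub_rev x (p j)]
    exact norm_sub_le_norm_sub_add_norm_sub _ _ _
  rcases lt_or_ge ε ‖x - p j‖ with hj | hj
  · exact Finset.sum_pos' (fun _ _ => le_max_left _ _)
      ⟨j, Finset.mem_univ j, lt_max_of_lt_right (sub_pos.2 hj)⟩
  · exact Finset.sum_pos' (fun _ _ => le_max_left _ _)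
      ⟨l, Finset.mem_univ l, lt_max_of_lt_right (by linarith)⟩

theorem coverWeight_mem (x : E) : coverWeight p ε x ∈ stdSimplex ℝ ι :=
  normalizeSum_mem (fun _ => le_max_left _ _) (coverWeight_sum_pos hp x)

theorem continuous_coverWeight : Continuous (coverWeight p ε) := by
  refine continuous_pi fun j => Continuous.div (by fun_prop) (by fun_prop) fun x =>
    (coverWeight_sum_pos hp x).ne'

end

/-- The points removed from the initial space of a face that are not removed from the final one. -/
def facePoints (y : (confCube n k).obj {i}) (T S : Finset {j : Fin k // j ≠ i})
    (j : {j // j ∈ S \ T}) : EuclideanSpace ℝ (Fin n) := confPoints y j.1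

/-- A face of the cube of punctured spaces. -/
abbrev face (y : (confCube n k).obj {i}) (T S : Finset {j : Fin k // j ≠ i}) :
    TopCube {j // j ∈ S \ T} := (puncturedCube (confPoints y)).face T S

/-- Data for a map to the homotopy colimit of a face of the cube of punctured spaces that is given
by a map to one of the spaces. -/
def coverData (y : (confCube n k).obj {i}) (T S : Finset {j : Fin k // j ≠ i}) {ε : ℝ} (hε : 0 < ε)
    {A : Type} [TopologicalSpace A] (U₀ : Finset {j // j ∈ S \ T})
    (f : C(A, ((puncturedCube (confPoints y)).face T S).obj U₀)) (w : C(A, {j // j ∈ S \ T} → ℝ))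
    (hw : ∀ a, w a ∈ stdSimplex ℝ _ ∧
      ∀ j ∈ U₀, coverWeight (facePoints y T S) ε (f a).1 j = 0 → w a j = 0) :
    ((puncturedCube (confPoints y)).face T S).HocolimData A where
  P a U := U ⊆ U₀ ∧ (f a).1 ∈ puncturedSpace (confPoints y) (FibCube.faceSet T S U) ∧
    ∀ j ∈ U, coverWeight (facePoints y T S) ε (f a).1 j = 0
  w := w
  x a U h := ⟨(f a).1, h.2.1⟩
  w_mem a U h := ⟨(hw a).1, fun j hj => (hw a).2 j (h.1 hj) (h.2.2 j hj)⟩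
  inter a U U' h h' := ⟨Finset.inter_subset_left.trans h.1,
    fun j hj => (FibCube.notMem_faceSet_inter hj).elim (h.2.1 j) (h'.2.1 j),
    fun j hj => h.2.2 j (Finset.mem_inter.1 hj).1⟩
  arrow _ _ _ _ _ _ := rfl
  eventually a := by
    classical
    have hf : Continuous fun a => (f a).1 := continuous_subtype_val.comp f.continuous
    have hd : ∀ j, Continuous fun a => ‖(f a).1 - facePoints y T S j‖ := fun j =>
      (hf.sub continuous_const).norm
    -- For `j` in this set, nearby points stay in the ball of radius `ε`, where the cover weight
    -- vanishes; for other `j` in `U₀` the distance is at least `ε > 0`, so nearby points differ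
    -- from `p j`.
    refine ⟨U₀.filter fun j => ‖(f a).1 - facePoints y T S j‖ < ε, ?_⟩
    have h : ∀ j, ∀ᶠ a' in nhds a,
        (‖(f a).1 - facePoints y T S j‖ < ε → ‖(f a').1 - facePoints y T S j‖ ≤ ε) ∧
        (¬ ‖(f a).1 - facePoints y T S j‖ < ε → (f a').1 ≠ facePoints y T S j) := by
      intro j
      by_cases hj : ‖(f a).1 - facePoints y T S j‖ < ε
      · filter_upwards [(hd j).continuousAt.eventually (gt_mem_nhds hj)] with a' ha'
        exact ⟨fun _ => ha'.le, fun h => absurd hj h⟩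
      · have hj' := hε.trans_le (not_lt.1 hj)
        filter_upwards [(hd j).continuousAt.eventually (lt_mem_nhds hj')] with a' ha'
        exact ⟨fun h => absurd h hj, fun _ => sub_ne_zero.1 (norm_pos_iff.1 ha')⟩
    filter_upwards [Filter.eventually_all.2 h] with a' ha'
    refine ⟨Finset.filter_subset _ _, fun j hj => ?_, fun j hj => ?_⟩
    · by_cases hU : j ∈ FibCube.faceSet T S U₀
      · rw [FibCube.mem_faceSet, not_or] at hj
        obtain ⟨hS, hU⟩ := (FibCube.mem_faceSet.1 hU).resolve_left hj.1
        exact (ha' ⟨j, hS⟩).2 fun h => hj.2 ⟨hS, Finset.mem_filter.2 ⟨hU, h⟩⟩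
      · exact (f a').2 j hU
    · exact coverWeight_eq_zero ((ha' j).1 (Finset.mem_filter.1 hj).2)
  continuous_w := w.continuous
  continuous_x U := Continuous.subtype_mk
    (continuous_subtype_val.comp (f.continuous.comp continuous_subtype_val)) _

/-- The map `D` pairs `x` with its cover weight, which has positive entries only where `x ≠ p j`; it
is a strict section. In the other order the point `x` is kept and the weight moves linearly from `t`
to the cover weight. This stays in the homotopy colimit: for `x` in the space of `U`, an entry in
`U` can become positive only if `x` avoids that point as well. -/
theorem isHtpyEquiv_hocolimMap (y : (confCube n k).obj {i}) (T S : Finset {j : Fin k // j ≠ i})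
    (hc : 2 ≤ (S \ T).card) :
    IsHtpyEquiv (face y T S).hocolimMap := by
  have : Nontrivial {j // j ∈ S \ T} := by
    rwa [← Finite.one_lt_card_iff_nontrivial, Nat.card_eq_fintype_card, Fintype.card_coe]
  have hinj : Function.Injective (facePoints y T S) := fun j l h =>
    Subtype.ext (confPoints_injective y h)
  obtain ⟨ε, hε, hp⟩ := exists_separation hinj
  let c : C(EuclideanSpace ℝ (Fin n), {j // j ∈ S \ T} → ℝ) :=
    ⟨coverWeight (facePoints y T S) ε, continuous_coverWeight hp⟩
  have hval : ∀ U, Continuous fun x : (face y T S).obj U => x.1 := fun U => continuous_subtype_val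
  let D := coverData y T S hε (A := (face y T S).obj Finset.univ) Finset.univ (.id _)
    (c.comp ⟨_, hval _⟩) fun x => ⟨coverWeight_mem hp _, fun _ _ => id⟩
  let G : ∀ U : {U : Finset {j // j ∈ S \ T} // U ≠ Finset.univ},
      (face y T S).HocolimData ((face y T S).obj U.1 × FaceSimplex U.1 × I) := fun U =>
    coverData y T S hε (A := (face y T S).obj U.1 × FaceSimplex U.1 × I) U.1
      ⟨Prod.fst, continuous_fst⟩
      ⟨fun a => (1 - (a.2.2 : ℝ)) • a.2.1.1 + (a.2.2 : ℝ) • c a.1.1, by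
        have h₁ : Continuous fun a : (face y T S).obj U.1 × FaceSimplex U.1 × I => a.2.1.1 :=
          FaceSimplex.continuous_val.comp (continuous_fst.comp continuous_snd)
        have h₂ : Continuous fun a : (face y T S).obj U.1 × FaceSimplex U.1 × I => c a.1.1 :=
          c.continuous.comp ((hval _).comp continuous_fst)
        fun_prop⟩
      fun a => ⟨convex_stdSimplex ℝ _ a.2.1.2.1 (coverWeight_mem hp _) (sub_nonneg.2 a.2.2.2.2)
        a.2.2.2.1 (sub_add_cancel _ _), fun j hj h => by
          have h₁ : a.2.1.1 j = 0 := a.2.1.2.2 j hj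
          have h₂ : c a.1.1 j = 0 := h
          simp [h₁, h₂]⟩
  have hD : (face y T S).hocolimMap.comp D.toMap = .id _ := by
    refine ContinuousMap.ext fun x => ?_
    obtain ⟨U, hU⟩ := D.exists_P x
    exact (congrArg (face y T S).hocolimMap (D.toMap_eq hU)).trans rfl
  refine ⟨D.toMap, ContinuousMap.Homotopic.symm ?_, hD ▸ ContinuousMap.Homotopic.refl _⟩
  refine TopCube.homotopic_of_hocolimMk (fun U s x t => (G U).toMap (x, t, s))
    (fun U => (G U).toMap.continuous) (fun U U' h s x t => ?_) (fun U x t => ?_) (fun U x t => ?_)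
  · obtain ⟨V, hV⟩ := (G U).exists_P (x, t.incl h, s)
    have hV' : (G U').P ((face y T S).arrow h x, t, s) V := ⟨hV.1.trans h, hV.2⟩
    exact ((G U).toMap_eq hV).trans ((G U').toMap_eq hV').symm
  · obtain ⟨V, hV⟩ := (G U).exists_P (x, t, 0)
    refine ((G U).toMap_eq hV).trans
      ((TopCube.hocolimMk_glue (S := ⟨V, ((G U).weight hV).ne_univ⟩) hV.1 _ _ t ?_).trans rfl)
    change (1 - ((0 : I) : ℝ)) • t.1 + ((0 : I) : ℝ) • c x.1 = t.1
    simp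
  · obtain ⟨V, hV⟩ := (G U).exists_P (x, t, 1)
    have hV' : D.P ((face y T S).arrow (Finset.subset_univ U.1) x) V := ⟨Finset.subset_univ V, hV.2⟩
    refine ((G U).toMap_eq hV).trans (Eq.trans ?_ (D.toMap_eq hV').symm)
    refine TopCube.hocolimMk_congr rfl ?_
    change (1 - ((1 : I) : ℝ)) • t.1 + ((1 : I) : ℝ) • c x.1 = c x.1
    simp

end PuncturedCube

/-- In the square formed by the two canonical maps and the maps induced by `ofPunctured`, three
sides are homotopy equivalences; hence so is the fourth. -/
theorem stronglyCocartesian_fibCube {n k : ℕ} {i : Fin k} (y : (confCube n k).obj {i}) :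
    (fibCube y).StronglyCocartesian := by
  intro T S _ hc
  refine IsHtpyEquiv.isWeakEquiv ?_
  refine (FibCube.isHtpyEquiv_hocolimFunctor y T S).of_comp ?_
  rw [TopCube.hocolimMap_comp_hocolimFunctor]
  exact (FibCube.isHtpyEquiv_ofPunctured y _).comp
    (PuncturedCube.isHtpyEquiv_hocolimMap y T S hc)

/-! ### The square faces of the cube of punctured spaces -/

theorem isOpen_puncturedSpace {n : ℕ} {J : Type} [Finite J] (b : J → EuclideanSpace ℝ (Fin n))
    (S : Finset J) : IsOpen (puncturedSpace b S) := by
  have h : puncturedSpace b S = ⋂ j, {x | j ∉ S → x ≠ b j} := by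
    ext x
    simp [puncturedSpace]
  rw [h]
  refine isOpen_iInter_of_finite fun j => ?_
  by_cases hj : j ∈ S
  · simp [hj]
  · simp only [hj, not_false_eq_true, forall_const]
    exact isOpen_ne

theorem puncturedSpace_inter {n : ℕ} {J : Type} [DecidableEq J] (b : J → EuclideanSpace ℝ (Fin n))
    (S : Finset J) {p q : J} (hpq : p ≠ q) :
    puncturedSpace b S = puncturedSpace b (insert p S) ∩ puncturedSpace b (insert q S) := by
  ext x
  simp only [puncturedSpace, Set.mem_ofPred_eq, Set.mem_inter_iff, Finset.mem_insert, not_or]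
  refine ⟨fun h => ⟨fun j hj => h j hj.2, fun j hj => h j hj.2⟩, fun h j hj => ?_⟩
  by_cases hjp : j = p
  · exact h.2 j ⟨fun hjq => hpq (hjp.symm.trans hjq), hj⟩
  · exact h.1 j ⟨hjp, hj⟩

/-- By injectivity a point is equal to at most one of `b p` and `b q`, so it avoids the other. -/
theorem puncturedSpace_union {n : ℕ} {J : Type} [DecidableEq J] {b : J → EuclideanSpace ℝ (Fin n)}
    (hb : Function.Injective b) (S : Finset J) {p q : J} (hpq : p ≠ q) :
    puncturedSpace b (insert p (insert q S)) =
      puncturedSpace b (insert p S) ∪ puncturedSpace b (insert q S) := by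
  ext x
  simp only [puncturedSpace, Set.mem_ofPred_eq, Set.mem_union, Finset.mem_insert, not_or]
  constructor
  · intro h
    by_cases hx : x = b q
    · refine Or.inr fun j hj => ?_
      by_cases hjp : j = p
      · rw [hx, hjp]
        exact fun he => hpq (hb he).symm
      · exact h j ⟨hjp, hj⟩
    · refine Or.inl fun j hj => ?_
      by_cases hjq : j = q
      · rwa [hjq]
      · exact h j ⟨hj.1, hjq, hj.2⟩
  · rintro (h | h) j hj
    · exact h j ⟨hj.1, hj.2.2⟩
    · exact h j ⟨hj.2.1, hj.2.2⟩

end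

theorem mainTheorem6 (n k : ℕ) (hk : 3 ≤ k) (i : Fin k) (y : (confCube n k).obj {i}) :
    ((confCube n k).hofiberCube i y).StronglyCocartesian ∧
    (∃ φ : puncturedCube (confPoints y) ⟶ (confCube n k).hofiberCube i y,
      ∀ S : Finset {j : Fin k // j ≠ i}, IsWeakEquiv (φ.app S).hom ∧
        ∀ x : puncturedSpace (confPoints y) S,
          ((φ.app S).hom x).1.1.1 ⟨i, notMem_liftSet S⟩ = x.1 ∧
          ∀ t : I, ((φ.app S).hom x).1.2 t = ((φ.app S).hom x).1.2 1) ∧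
    (∀ (S : Finset {j : Fin k // j ≠ i}) (p q : {j : Fin k // j ≠ i}),
      p ∉ S → q ∉ S → p ≠ q →
      IsOpen (puncturedSpace (confPoints y) (insert p S)) ∧
      IsOpen (puncturedSpace (confPoints y) (insert q S)) ∧
      puncturedSpace (confPoints y) S =
        puncturedSpace (confPoints y) (insert p S) ∩ puncturedSpace (confPoints y) (insert q S) ∧
      puncturedSpace (confPoints y) (insert p (insert q S)) =
        puncturedSpace (confPoints y) (insert p S) ∪ puncturedSpace (confPoints y) (insert q S)) := by
  refine ⟨stronglyCocartesian_fibCube y, ⟨FibCube.ofPunctured y, fun S =>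
    ⟨(FibCube.isHtpyEquiv_ofPunctured y S).isWeakEquiv, fun x =>
      ⟨FibCube.pt_mk (FibCube.good_const x.2), fun t => rfl⟩⟩⟩, fun S p q _ _ hpq =>
    ⟨isOpen_puncturedSpace _ _, isOpen_puncturedSpace _ _, puncturedSpace_inter _ S hpq,
      puncturedSpace_union (confPoints_injective y) S hpq⟩⟩
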